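/- **Setting.** For $p\ge 1$ let $\|\alpha\|_p=(\sum_{i=1}^d|\alpha_i|^p)^{1/p}$ and $B_p^d=\{\alpha\in\mathbb R^d:\|\alpha\|_p\le 1\}$. For a convex body $K\subset\mathbb R^d$ containing $0$ in its interior let $\varphi_K(\alpha)=\inf\{s>0:\alpha\in sK\}$ be its Minkowski functional. For a differentiable $\psi$ let $D_\psi(\alpha,\alpha')=\psi(\alpha)-\psi(\alpha')-\langle\nabla\psi(\alpha'),\alpha-\alpha'\rangle$. Given $X\in\mathbb R^{n\times d}$ with $n,d\ge1$, $\alpha^\star\in\mathbb R^d$ and noise $\xi\sim\mathcal N(0,I_n)$, let $y=X\alpha^\star+\xi$, $\mathcal R_n(\alpha)=\frac1n\|X\alpha-y\|_2^2$ and $\mathcal R(\alpha)=\frac1n\|X(\alpha-\alpha^\star)\|_2^2$. A function $\psi:\mathbb R^d\to[0,\infty)$ satisfies the *discrete-time assumptions* for $K$ and $\tau>0$, with strong convexity parameter $\rho>0$ with respect to a norm $\|\cdot\|$ and approximation constant $c_a=c_lc_u$ ($c_l,c_u>0$), if: (I) $\psi$ is differentiable and $\nabla\psi(0)=0$; (II)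 $\sqrt\psi$ is convex; (III) $D_\psi(\alpha,\alpha')\ge\frac\rho2\|\alpha-\alpha'\|^2$ for all $\alpha,\alpha'$; (IV) $\varphi_K(\alpha)\le c_l\sqrt{\psi(\alpha)}$ for all $\alpha\in\mathbb R^d$, and $\sqrt{\psi(\alpha)}\le c_u\tau$ for all $\alpha\in\tau K$. *Early-stopped mirror descent.* Let $p\in(1,2)$, $\psi=\|\cdot\|_p^2$ and $\rho=2(p-1)$. The iterates are $\alpha_0=0$, $\nabla\psi(\alpha_{t+1})=\nabla\psi(\alpha_t)-\eta\nabla\mathcal R_n(\alpha_t)$. A step size $\eta>0$ is admissible if $\eta\le\rho/\beta$ for some $\beta>0$ such that $\mathcal R_n$ is $\beta$-smooth with respect to $\|\cdot\|_p$, i.e. $\mathcal R_n(\alpha)\le\mathcal R_n(\alpha')+\langle\nabla\mathcal R_n(\alpha'),\alpha-\alpha'\rangle+\frac\beta2\|\alpha-\alpha'\|_p^2$ for all $\alpha,\alpha'$, and, when $\alpha^\star\ne0$, also $\eta\le\frac12D_\psi(\alpha^\star,0)$. For $\varepsilon>0$ put $T_\varepsilon=\lceil 2\tau^2/(\varepsilon\eta)\rceil$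 and let $t^\star\in\arg\min_{0\le t\le T_\varepsilon}\mathcal R(\alpha_t)$. **Proposition 4.1.** Let $p\in(1,2)$ and $\frac1p+\frac1q=1$. 1. The potential $\psi=\|\cdot\|_p^2$ is differentiable and strictly convex with surjective gradient (so that mirror descent is well defined), and for $K=B_p^d$ and every $\tau>0$ it satisfies the discrete-time assumptions with $\rho=2(p-1)$ with respect to $\|\cdot\|_p$ and with $c_l=c_u=1$, so that $c_a=1$. 2. Let $\tau>0$, $\delta\in(0,1)$, and let $X$ be column-normalized, i.e. every column satisfies $\|X_i\|_2\le\sqrt n$. Put $$b=\Big(\frac{16\,\mathrm{rank}(X)}{n}\wedge 48\,\tau\sqrt{\frac{\log d}{n}}\;d^{1/q}\Big)+\frac{8\log(1/\delta)}{n}.$$ With probability at least $1-e^{-0.1n}-\delta$ over $\xi$, for all $\alpha^\star\in\tau B_p^d$ and all admissible $\eta$, mirror descent optimally stopped within $T_\varepsilon$ steps, $\varepsilon=b/2$, satisfies $\mathcal R(\alpha_{t^\star})\le b$. 3. There is an absolute constant $C>0$ (independent of $p,n,d,\tau$) such that the following holds for all $n\ge1$, $d\ge2$, $\tau>0$. Put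 $$r=1\wedge\frac{\tau}{\sqrt n}\begin{cases}\sqrt{\log d}&\text{if }1<p\le1+\frac1{\log d},\\ \sqrt q\,d^{1/q}&\text{if }1+\frac1{\log d}<p<2.\end{cases}$$ If $X$ has i.i.d. $\mathcal N(0,1)$ entries and is independent of $\xi$, then with probability at least $0.99-2e^{-0.1n}$ jointly over $X$ and $\xi$, for all $\alpha^\star\in\tau B_p^d$ and all admissible $\eta$, mirror descent optimally stopped within $T_\varepsilon$ steps, $\varepsilon=r$, satisfies $\mathcal R(\alpha_{t^\star})\le C\,r$. -/

import Mathlib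

open MeasureTheory ProbabilityTheory
open scoped Pointwise

noncomputable section

namespace ESMD

/-! ### Norms, Bregman divergence, strong convexity, smoothness -/

/-- The parameter space `ℝ^d`, with its Euclidean inner product (used for gradients). -/
abbrev Param (d : ℕ) : Type := EuclideanSpace ℝ (Fin d)

/-- The norm `‖α‖_p = (∑ i, |α i| ^ p) ^ (1 / p)`. -/
def lpNorm (p : ℝ) {d : ℕ} (α : Param d) : ℝ := (∑ i, |α i| ^ p) ^ (1 / p)

/-- The unit ball `B_p^d`. -/
def lpBall (p : ℝ) (d : ℕ) : Set (Param d) := {α | lpNorm p α ≤ 1}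

/-- The potential `ψ(α) = ‖α‖_p ^ 2`. -/
def lpPotential (p : ℝ) {d : ℕ} (α : Param d) : ℝ := lpNorm p α ^ 2

/-- `N` is a norm on `ℝ^d`. -/
structure IsNorm {d : ℕ} (N : Param d → ℝ) : Prop where
  nonneg : ∀ x, 0 ≤ N x
  eq_zero : ∀ x, N x = 0 → x = 0
  smul : ∀ (c : ℝ) (x : Param d), N (c • x) = |c| * N x
  add_le : ∀ x y, N (x + y) ≤ N x + N y

/-- The Bregman divergence `D_ψ(α, α') = ψ(α) - ψ(α') - ⟨∇ψ(α'), α - α'⟩`. -/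
def bregman {d : ℕ} (ψ : Param d → ℝ) (α α' : Param d) : ℝ :=
  ψ α - ψ α' - inner ℝ (gradient ψ α') (α - α')

/-- `ψ` is `ρ`-strongly convex with respect to `N`. -/
def StronglyConvexWrt {d : ℕ} (N : Param d → ℝ) (ρ : ℝ) (ψ : Param d → ℝ) : Prop :=
  ∀ α α', ρ / 2 * N (α - α') ^ 2 ≤ bregman ψ α α'

/-- `f` is `β`-smooth with respect to `N`. -/
def SmoothWrt {d : ℕ} (N : Param d → ℝ) (β : ℝ) (f : Param d → ℝ) : Prop :=
  ∀ α α', f α ≤ f α' + inner ℝ (gradient f α') (α - α') + β / 2 * N (α - α') ^ 2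

/-! ### Mirror descent -/

/-- The requirements on a potential under which the discrete-time mirror descent
recursion defines its iterates (and defines them uniquely). -/
structure IsMirrorMap {d : ℕ} (ψ : Param d → ℝ) : Prop where
  differentiable : Differentiable ℝ ψ
  strictConvex : StrictConvexOn ℝ Set.univ ψ
  surjective : Function.Surjective (gradient ψ)

/-- `α` is the sequence of iterates of discrete-time mirror descent on `f`, with potential `ψ`
and step size `η`, started at `0`. -/
def IsMirrorDescent {d : ℕ} (ψ f : Param d → ℝ) (η : ℝ) (α : ℕ → Param d) : Prop :=
  α 0 = 0 ∧ ∀ t, gradient ψ (α (t + 1)) = gradient ψ (α t) - η • gradient f (α t)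

/-- The conditions on a potential `ψ` for discrete-time mirror descent over the convex body `K`
with radius `τ`: the strong convexity is with respect to the norm `N` with parameter `ρ`, and the
approximation constant is `c_a = cl * cu`. The Minkowski functional of `K` is `gauge K`. -/
structure DiscreteAssumption {d : ℕ} (K : Set (Param d)) (τ : ℝ) (N : Param d → ℝ)
    (ρ cl cu : ℝ) (ψ : Param d → ℝ) : Prop where
  nonneg : ∀ α, 0 ≤ ψ α
  differentiable : Differentiable ℝ ψ
  gradient_zero : gradient ψ 0 = 0
  sqrt_convex : ConvexOn ℝ Set.univ (fun α => Real.sqrt (ψ α))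
  isNorm : IsNorm N
  rho_pos : 0 < ρ
  stronglyConvex : StronglyConvexWrt N ρ ψ
  cl_pos : 0 < cl
  cu_pos : 0 < cu
  gauge_le : ∀ α, gauge K α ≤ cl * Real.sqrt (ψ α)
  sqrt_le : ∀ α ∈ τ • K, Real.sqrt (ψ α) ≤ cu * τ

/-! ### Linear regression -/

/-- The squared Euclidean norm of a vector in `ℝ^n`. -/
def sqNorm {n : ℕ} (v : Fin n → ℝ) : ℝ := ‖WithLp.toLp 2 v‖ ^ 2

/-- The responses `y = X α⋆ + ξ`. -/
def response {n d : ℕ} (X : Matrix (Fin n) (Fin d) ℝ) (αs : Param d) (ξ : Fin n → ℝ) :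
    Fin n → ℝ :=
  X.mulVec αs.ofLp + ξ

/-- The empirical risk `R_n(α) = ‖X α - y‖₂² / n`. -/
def empiricalRisk {n d : ℕ} (X : Matrix (Fin n) (Fin d) ℝ) (y : Fin n → ℝ) (α : Param d) : ℝ :=
  (1 / (n : ℝ)) * sqNorm (X.mulVec α.ofLp - y)

/-- The in-sample risk `R(α) = ‖X (α - α⋆)‖₂² / n`. -/
def inSampleRisk {n d : ℕ} (X : Matrix (Fin n) (Fin d) ℝ) (αs α : Param d) : ℝ :=
  (1 / (n : ℝ)) * sqNorm (X.mulVec (α - αs).ofLp)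

/-- `X` is column-normalized: every column has Euclidean norm at most `√n`. -/
def ColumnNormalized {n d : ℕ} (X : Matrix (Fin n) (Fin d) ℝ) : Prop :=
  ∀ j, ‖WithLp.toLp 2 (fun i => X i j)‖ ≤ Real.sqrt n

/-- The in-sample risk `R(α_{t⋆})` at an optimal stopping time
`t⋆ ∈ argmin {R(α_t) | 0 ≤ t ≤ T}`. -/
def earlyStoppedRisk {n d : ℕ} (X : Matrix (Fin n) (Fin d) ℝ) (αs : Param d)
    (α : ℕ → Param d) (T : ℕ) : ℝ :=
  (Finset.range (T + 1)).inf' Finset.nonempty_range_add_one (fun t => inSampleRisk X αs (α t))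

/-- The maximal number of iterations `T = ⌈2 cu² τ² / (ε η)⌉`. -/
def horizon (cu τ ε η : ℝ) : ℕ := ⌈2 * cu ^ 2 * τ ^ 2 / (ε * η)⌉₊

/-- Admissible step sizes: `0 < η ≤ ρ / β ∧ D_ψ(α⋆, 0) / 2`, where the empirical risk is
`β`-smooth with respect to the norm `N`. The condition `η ≤ D_ψ(α⋆, 0) / 2` is imposed
only for `α⋆ ≠ 0`, as no positive `η` satisfies it for `α⋆ = 0`. -/
structure AdmissibleStep {n d : ℕ} (ψ N : Param d → ℝ) (ρ : ℝ) (X : Matrix (Fin n) (Fin d) ℝ)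
    (αs : Param d) (β η : ℝ) : Prop where
  beta_pos : 0 < β
  smooth : ∀ y, SmoothWrt N β (empiricalRisk X y)
  eta_pos : 0 < η
  eta_le : η ≤ ρ / β
  eta_le_bregman : αs ≠ 0 → η ≤ bregman ψ αs 0 / 2

/-- For the design `X` and the noise `ξ`: whatever the ground truth `α⋆ ∈ τ B_p^d` and the
admissible step size `η`, the iterates of mirror descent with potential `‖·‖_p²` on the empirical
risk of `y = X α⋆ + ξ`, optimally stopped within `⌈2 τ² / (ε η)⌉` steps, have in-sample risk at
most `b`. -/
def LpESMDRiskLE (p τ ε b : ℝ) {n d : ℕ} (X : Matrix (Fin n) (Fin d) ℝ) (ξ : Fin n → ℝ) : Prop :=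
  ∀ αs ∈ τ • lpBall p d, ∀ β η : ℝ,
    AdmissibleStep (lpPotential p) (lpNorm p) (2 * (p - 1)) X αs β η →
    ∀ α : ℕ → Param d,
      IsMirrorDescent (lpPotential p) (empiricalRisk X (response X αs ξ)) η α →
      earlyStoppedRisk X αs α (horizon 1 τ ε η) ≤ b

/-! ### Probability -/

/-- The law `N(0, I_n)` of the noise. -/
def noiseLaw (n : ℕ) : Measure (Fin n → ℝ) := Measure.pi fun _ => gaussianReal 0 1

/-- The law of the array of i.i.d. standard Gaussian entries of a Gaussian design. -/
def designLaw (n d : ℕ) : Measure (Fin n → Fin d → ℝ) :=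
  Measure.pi fun _ => Measure.pi fun _ => gaussianReal 0 1

/-- `S` holds with probability at least `c`: it contains a measurable event of
probability at least `c`. -/
def WithProbAtLeast {Ω : Type*} [MeasurableSpace Ω] (μ : Measure Ω) (c : ℝ) (S : Set Ω) : Prop :=
  ∃ E, MeasurableSet E ∧ E ⊆ S ∧ c ≤ μ.real E

/-! ### The rates -/

/-- The bound for a column-normalized design:
`(16 rank X / n ∧ 48 τ √(log d / n) d^{1/q}) + 8 log (1/δ) / n`. -/
def columnBound (q τ δ : ℝ) {n d : ℕ} (X : Matrix (Fin n) (Fin d) ℝ) : ℝ :=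
  min (16 * (X.rank : ℝ) / n)
      (48 * τ * Real.sqrt (Real.log d / n) * (d : ℝ) ^ (1 / q))
    + 8 * Real.log (1 / δ) / n

open Classical in
/-- The rate for a Gaussian design:
`1 ∧ (τ / √n) √(log d)` if `p ≤ 1 + 1 / log d`, and `1 ∧ (τ / √n) √q d^{1/q}` otherwise. -/
def gaussianRate (p q τ : ℝ) (n d : ℕ) : ℝ :=
  min 1 (τ / Real.sqrt n *
    if p ≤ 1 + 1 / Real.log d then Real.sqrt (Real.log d) else Real.sqrt q * (d : ℝ) ^ (1 / q))

end ESMD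

end

namespace ESMD

/-! ### The `ℓ_p` norm -/

/-! The proof separates a deterministic potential argument from bounds on a Gaussian process. A
mirror step changes `D(α⋆, α_t)` by at most `-η (R(α_t) + R_n(α_{t+1}) - R_n(α⋆))`
(`bregman_step_le`): strong convexity of the potential pays for smoothness, and the exactly
quadratic `R_n` supplies the term `R(α_t)`. A divergence cannot become negative, so within the
horizon there is a first `t` at which the bracket is at most `ε`. Until then the divergence has not
grown, which keeps `α_{t+1}` in an `ℓ_p` ball of radius of order `τ`. As `R_n(α_{t+1}) - R_n(α⋆)` is
`-1/n` times the offset process `2⟨ξ, XΔ⟩ - ‖XΔ‖²` at `Δ = α_{t+1} - α⋆`, an upper bound for that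
process on a ball gives the risk bound (`lpESMDRiskLE_of_offset`).

The offset process is bounded in three ways: on the whole column space by a chi-square moment
(`offset_rank_bound`), on an enclosing `ℓ_1` ball by Maurey sparsification and a union bound
(`offset_sum_abs_bound`), and for a Gaussian design by Hölder duality, with `Xᵀξ` controlled by one
exponential sum (`exists_design_bad_set`).

Strong convexity of `‖·‖_p²` comes from a Hessian bound for a smoothed norm, which is an instance of
Hölder (`lpNorm_sq_le_weighted`). -/

lemma lpNorm_nonneg (p : ℝ) {d : ℕ} (α : Param d) : 0 ≤ lpNorm p α :=
  Real.rpow_nonneg (Finset.sum_nonneg fun _ _ => Real.rpow_nonneg (abs_nonneg _) _) _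

lemma sum_abs_rpow_nonneg (p : ℝ) {d : ℕ} (α : Param d) : 0 ≤ ∑ i, |α i| ^ p :=
  Finset.sum_nonneg fun _ _ => Real.rpow_nonneg (abs_nonneg _) _

lemma lpNorm_smul {p : ℝ} (hp : 1 < p) {d : ℕ} (c : ℝ) (α : Param d) :
    lpNorm p (c • α) = |c| * lpNorm p α := by
  have hp0 : 0 < p := by linarith
  unfold lpNorm
  have h : ∑ i, |(c • α) i| ^ p = |c| ^ p * ∑ i, |α i| ^ p := by
    rw [Finset.mul_sum]
    refine Finset.sum_congr rfl fun i _ => ?_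
    rw [PiLp.smul_apply, smul_eq_mul, abs_mul, Real.mul_rpow (abs_nonneg _) (abs_nonneg _)]
  rw [h, Real.mul_rpow (Real.rpow_nonneg (abs_nonneg _) _) (sum_abs_rpow_nonneg p α),
    ← Real.rpow_mul (abs_nonneg _), mul_one_div_cancel hp0.ne', Real.rpow_one]

lemma lpNorm_add_le {p : ℝ} (hp : 1 < p) {d : ℕ} (α β : Param d) :
    lpNorm p (α + β) ≤ lpNorm p α + lpNorm p β :=
  Real.Lp_add_le Finset.univ (fun i => α i) (fun i => β i) hp.le

lemma lpNorm_sub_le {p : ℝ} (hp : 1 < p) {d : ℕ} (α β : Param d) :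
    lpNorm p (α - β) ≤ lpNorm p α + lpNorm p β := by
  have h := lpNorm_add_le hp α ((-1 : ℝ) • β)
  rw [lpNorm_smul hp] at h
  simpa [sub_eq_add_neg] using h

lemma abs_le_lpNorm {p : ℝ} (hp : 1 < p) {d : ℕ} (α : Param d) (i : Fin d) :
    |α i| ≤ lpNorm p α := by
  have hp0 : 0 < p := by linarith
  have h : |α i| ^ p ≤ ∑ i, |α i| ^ p :=
    Finset.single_le_sum (f := fun i => |α i| ^ p)
      (fun i _ => Real.rpow_nonneg (abs_nonneg _) _) (Finset.mem_univ i)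
  calc |α i| = (|α i| ^ p) ^ (1 / p) := by
        rw [← Real.rpow_mul (abs_nonneg _), mul_one_div_cancel hp0.ne', Real.rpow_one]
    _ ≤ _ := Real.rpow_le_rpow (Real.rpow_nonneg (abs_nonneg _) _) h (by positivity)

lemma isNorm_lpNorm {p : ℝ} (hp : 1 < p) (d : ℕ) : IsNorm (lpNorm p (d := d)) where
  nonneg := lpNorm_nonneg p
  eq_zero x hx := by
    ext i
    have := abs_le_lpNorm hp x i
    rw [hx] at this
    simpa using this
  smul := lpNorm_smul hp
  add_le := lpNorm_add_le hp

lemma lpNorm_zero {p : ℝ} (hp : 1 < p) (d : ℕ) : lpNorm p (0 : Param d) = 0 := by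
  simpa using lpNorm_smul hp 0 (0 : Param d)

lemma lpNorm_le_of_mem_smul_lpBall {p : ℝ} (hp : 1 < p) {d : ℕ} {τ : ℝ} (hτ : 0 ≤ τ)
    {α : Param d} (h : α ∈ τ • lpBall p d) : lpNorm p α ≤ τ := by
  obtain ⟨β, hβ, rfl⟩ := h
  simp only [lpNorm_smul hp, abs_of_nonneg hτ]
  exact mul_le_of_le_one_right hτ hβ

lemma gauge_lpBall_le {p : ℝ} (hp : 1 < p) {d : ℕ} (α : Param d) :
    gauge (lpBall p d) α ≤ lpNorm p α := by
  rcases (lpNorm_nonneg p α).eq_or_lt with h | h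
  · rw [(isNorm_lpNorm hp d).eq_zero α h.symm, gauge_zero]
    exact lpNorm_nonneg p _
  · refine gauge_le_of_mem h.le ⟨(lpNorm p α)⁻¹ • α, ?_, by simp [smul_smul, h.ne']⟩
    simp [lpBall, lpNorm_smul hp, abs_of_pos h, h.ne']

lemma norm_sq_le_lpNorm_sq {p : ℝ} (hp : 1 < p) {d : ℕ} (α : Param d) :
    ‖α‖ ^ 2 ≤ d * lpNorm p α ^ 2 := by
  rw [EuclideanSpace.norm_sq_eq]
  calc ∑ i, ‖α i‖ ^ 2 ≤ ∑ _i : Fin d, lpNorm p α ^ 2 :=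
        Finset.sum_le_sum fun i _ => by
          rw [Real.norm_eq_abs]
          exact pow_le_pow_left₀ (abs_nonneg _) (abs_le_lpNorm hp α i) 2
    _ = _ := by simp

/-! ### The potential -/

lemma lpPotential_eq {p : ℝ} {d : ℕ} (α : Param d) :
    lpPotential p α = (∑ i, |α i| ^ p) ^ (2 / p) := by
  unfold lpPotential lpNorm
  rw [← Real.rpow_natCast, ← Real.rpow_mul (sum_abs_rpow_nonneg p α)]
  congr 1
  push_cast
  ring

lemma differentiable_lpPotential {p : ℝ} (hp : 1 < p) (hp2 : p < 2) (d : ℕ) :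
    Differentiable ℝ (lpPotential p (d := d)) := by
  have h : lpPotential p (d := d) = fun α => (∑ i, |α i| ^ p) ^ (2 / p) :=
    funext lpPotential_eq
  rw [h]
  refine Differentiable.rpow_const ?_ (fun x => Or.inr ?_)
  · refine Differentiable.fun_sum fun i _ => ?_
    have h1 : Differentiable ℝ fun x : ℝ => |x| ^ p :=
      fun x => (hasDerivAt_abs_rpow x hp).differentiableAt
    exact h1.comp (by fun_prop : Differentiable ℝ fun α : Param d => α i)
  -- The outer exponent `2 / p` is at least `1`, so the power is differentiable even where the sum
  -- vanishes.
  · rw [le_div_iff₀ (by linarith)]; linarith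

/-! ### Strong convexity of the squared `ℓ_p` norm -/

lemma hasDerivAt_line {d : ℕ} {ψ : Param d → ℝ} (hψ : Differentiable ℝ ψ) (b v : Param d) :
    HasDerivAt (fun s : ℝ => ψ (b + s • v)) (inner ℝ (gradient ψ b) v) 0 := by
  have h1 : HasDerivAt (fun s : ℝ => b + s • v) v 0 := by
    simpa using ((hasDerivAt_id (0 : ℝ)).smul_const v).const_add b
  have h2 : HasFDerivAt ψ (InnerProductSpace.toDual ℝ _ (gradient ψ b)) (b + (0 : ℝ) • v) := by
    simpa using (hψ b).hasGradientAt.hasFDerivAt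
  exact h2.comp_hasDerivAt (0 : ℝ) h1

/-- Hölder with exponents `2 / (2 - p)` and `2 / p`, after inserting a power of `u i` and its
inverse into `|v i| ^ p`. For `u i = x i ^ 2 + ε` the right side times `2 (p - 1)` is a lower bound
for the Hessian of the smoothed potential in direction `v`. -/
lemma lpNorm_sq_le_weighted {p : ℝ} (hp : 1 < p) (hp2 : p < 2) {d : ℕ} (v u : Fin d → ℝ)
    (hu : ∀ i, 0 < u i) :
    (∑ i, |v i| ^ p) ^ (2 / p) ≤
      (∑ i, u i ^ (p / 2)) ^ (2 / p - 1) * ∑ i, u i ^ (p / 2 - 1) * v i ^ 2 := by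
  have hp0 : 0 < p := by linarith
  have hA : 0 ≤ ∑ i, u i ^ (p / 2) := Finset.sum_nonneg fun i _ => Real.rpow_nonneg (hu i).le _
  have hB : 0 ≤ ∑ i, u i ^ (p / 2 - 1) * v i ^ 2 :=
    Finset.sum_nonneg fun i _ => mul_nonneg (Real.rpow_nonneg (hu i).le _) (sq_nonneg _)
  have hpq : Real.HolderConjugate (2 / (2 - p)) (2 / p) := by
    rw [Real.holderConjugate_iff]
    constructor
    · rw [lt_div_iff₀ (by linarith)]; linarith
    · rw [inv_div, inv_div]; ring
  have H := Real.inner_le_Lp_mul_Lq_of_nonneg Finset.univ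
    (f := fun i => u i ^ (p * (2 - p) / 4)) (g := fun i => u i ^ (-(p * (2 - p) / 4)) * |v i| ^ p)
    hpq (fun i _ => Real.rpow_nonneg (hu i).le _)
    (fun i _ => mul_nonneg (Real.rpow_nonneg (hu i).le _) (Real.rpow_nonneg (abs_nonneg _) _))
  have e1 : ∑ i, u i ^ (p * (2 - p) / 4) * (u i ^ (-(p * (2 - p) / 4)) * |v i| ^ p) =
      ∑ i, |v i| ^ p := by
    refine Finset.sum_congr rfl fun i _ => ?_
    rw [← mul_assoc, ← Real.rpow_add (hu i)]
    simp
  have e2 : ∑ i, (u i ^ (p * (2 - p) / 4)) ^ (2 / (2 - p)) = ∑ i, u i ^ (p / 2) := by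
    refine Finset.sum_congr rfl fun i _ => ?_
    rw [← Real.rpow_mul (hu i).le]
    congr 1
    field_simp [(by linarith : (2 - p) ≠ 0)]
    norm_num
  have e3 : ∑ i, (u i ^ (-(p * (2 - p) / 4)) * |v i| ^ p) ^ (2 / p) =
      ∑ i, u i ^ (p / 2 - 1) * v i ^ 2 := by
    refine Finset.sum_congr rfl fun i _ => ?_
    rw [Real.mul_rpow (Real.rpow_nonneg (hu i).le _) (Real.rpow_nonneg (abs_nonneg _) _),
      ← Real.rpow_mul (hu i).le, ← Real.rpow_mul (abs_nonneg _), mul_div_cancel₀ _ hp0.ne',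
      ← sq_abs (v i), ← Real.rpow_natCast |v i| 2]
    congr 2
    field_simp
    ring
  rw [e1, e2, e3, one_div_div, one_div_div] at H
  calc (∑ i, |v i| ^ p) ^ (2 / p)
      ≤ ((∑ i, u i ^ (p / 2)) ^ ((2 - p) / 2) *
          (∑ i, u i ^ (p / 2 - 1) * v i ^ 2) ^ (p / 2)) ^ (2 / p) :=
        Real.rpow_le_rpow (Finset.sum_nonneg fun i _ => Real.rpow_nonneg (abs_nonneg _) _) H
          (by positivity)
    _ = _ := by
        rw [Real.mul_rpow (Real.rpow_nonneg hA _) (Real.rpow_nonneg hB _), ← Real.rpow_mul hA,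
          ← Real.rpow_mul hB, div_mul_div_comm, div_mul_div_comm, mul_comm p 2,
          div_self (by positivity), Real.rpow_one]
        congr 2
        field_simp

/-- The smoothed potential `(∑ i, (x i ^ 2 + ε) ^ (p / 2)) ^ (2 / p)` minus a quadratic is convex
along lines. -/
lemma convexOn_smoothed_line {p : ℝ} (hp : 1 < p) (hp2 : p < 2) {d : ℕ} (hd : 1 ≤ d)
    (b v : Fin d → ℝ) {ε : ℝ} (hε : 0 < ε) :
    ConvexOn ℝ Set.univ (fun s : ℝ => (∑ i, ((b i + s * v i) ^ 2 + ε) ^ (p / 2)) ^ (2 / p) -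
      (p - 1) * (∑ i, |v i| ^ p) ^ (2 / p) * s ^ 2) := by
  have hp0 : 0 < p := by linarith
  have : Nonempty (Fin d) := ⟨⟨0, hd⟩⟩
  set V := (∑ i, |v i| ^ p) ^ (2 / p) with hV
  set u : Fin d → ℝ → ℝ := fun i s => (b i + s * v i) ^ 2 + ε with hu
  have upos : ∀ i s, 0 < u i s := fun i s => by simp only [hu]; positivity
  have hu' : ∀ i s, HasDerivAt (u i) (2 * (b i + s * v i) * v i) s := fun i s => by
    have h1 : HasDerivAt (fun s => b i + s * v i) (v i) s := by
      simpa using ((hasDerivAt_id s).mul_const (v i)).const_add (b i)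
    exact ((h1.pow 2).add_const ε).congr_deriv (by simp)
  set S : ℝ → ℝ := fun s => ∑ i, u i s ^ (p / 2) with hS
  set S1 : ℝ → ℝ := fun s => ∑ i, p * u i s ^ (p / 2 - 1) * ((b i + s * v i) * v i) with hS1
  set S2 : ℝ → ℝ := fun s => ∑ i, (p * u i s ^ (p / 2 - 1) * v i ^ 2 +
    p * (p - 2) * u i s ^ (p / 2 - 2) * ((b i + s * v i) ^ 2 * v i ^ 2)) with hS2
  have Spos : ∀ s, 0 < S s := fun s =>
    Finset.sum_pos (fun i _ => Real.rpow_pos_of_pos (upos i s) _) Finset.univ_nonempty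
  have dS : ∀ s, HasDerivAt S (S1 s) s := fun s => by
    refine HasDerivAt.fun_sum fun i _ => ?_
    exact ((hu' i s).rpow_const (p := p / 2) (Or.inl (upos i s).ne')).congr_deriv (by ring)
  have dS1 : ∀ s, HasDerivAt S1 (S2 s) s := fun s => by
    refine HasDerivAt.fun_sum fun i _ => ?_
    have h1 : HasDerivAt (fun s => (b i + s * v i) * v i) (v i * v i) s := by
      simpa using (((hasDerivAt_id s).mul_const (v i)).const_add (b i)).mul_const (v i)
    refine ((((hu' i s).rpow_const (p := p / 2 - 1) (Or.inl (upos i s).ne')).const_mul p).mul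
      h1).congr_deriv ?_
    rw [show p / 2 - 1 - 1 = p / 2 - 2 by ring]
    ring
  have dF : ∀ s, HasDerivAt (fun s => S s ^ (2 / p) - (p - 1) * V * s ^ 2)
      ((2 / p) * S s ^ (2 / p - 1) * S1 s - (p - 1) * V * (2 * s)) s := fun s => by
    refine (((dS s).rpow_const (p := 2 / p) (Or.inl (Spos s).ne')).sub
      ((hasDerivAt_pow 2 s).const_mul ((p - 1) * V))).congr_deriv ?_
    norm_num
    ring
  have dF1 : ∀ s, HasDerivAt
      (fun s => (2 / p) * S s ^ (2 / p - 1) * S1 s - (p - 1) * V * (2 * s))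
      ((2 / p) * (2 / p - 1) * S s ^ (2 / p - 2) * S1 s ^ 2 + (2 / p) * S s ^ (2 / p - 1) * S2 s
        - 2 * (p - 1) * V) s := fun s => by
    refine (((((dS s).rpow_const (p := 2 / p - 1) (Or.inl (Spos s).ne')).const_mul (2 / p)).mul
      (dS1 s)).sub (((hasDerivAt_id s).const_mul 2).const_mul ((p - 1) * V))).congr_deriv ?_
    rw [show 2 / p - 1 - 1 = 2 / p - 2 by ring]
    ring
  refine convexOn_of_hasDerivWithinAt2_nonneg convex_univ
    (fun s _ => (dF s).continuousAt.continuousWithinAt)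
    (fun s _ => (dF s).hasDerivWithinAt) (fun s _ => (dF1 s).hasDerivWithinAt) fun s _ => ?_
  -- The part of the second derivative carrying `S1 ^ 2` is nonnegative since `2 / p ≥ 1`, and is
  -- dropped.
  have h1 : 0 ≤ (2 / p) * (2 / p - 1) * S s ^ (2 / p - 2) * S1 s ^ 2 := by
    have : 0 ≤ 2 / p - 1 := by
      rw [sub_nonneg, le_div_iff₀ hp0]; linarith
    have := Real.rpow_nonneg (Spos s).le (2 / p - 2)
    positivity
  -- Since `x ^ 2 ≤ u`, the term with `p - 2 < 0` costs at most `p (2 - p) u ^ (p / 2 - 1) v ^ 2`,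
  -- leaving the factor `p (p - 1)`.
  have h2 : p * (p - 1) * ∑ i, u i s ^ (p / 2 - 1) * v i ^ 2 ≤ S2 s := by
    rw [Finset.mul_sum]
    refine Finset.sum_le_sum fun i _ => ?_
    have e : u i s ^ (p / 2 - 1) = u i s ^ (p / 2 - 2) * u i s := by
      rw [← Real.rpow_add_one (upos i s).ne']; congr 1; ring
    have hw := (Real.rpow_pos_of_pos (upos i s) (p / 2 - 2)).le
    have hx : u i s = (b i + s * v i) ^ 2 + ε := rfl
    have : 0 ≤ p * (2 - p) * u i s ^ (p / 2 - 2) * ε * v i ^ 2 := by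
      have : 0 ≤ 2 - p := by linarith
      positivity
    rw [e]
    generalize u i s ^ (p / 2 - 2) = w at *
    rw [hx]
    nlinarith
  have h3 := lpNorm_sq_le_weighted hp hp2 v (fun i => u i s) (fun i => upos i s)
  have h4 : 2 * (p - 1) * V ≤ (2 / p) * S s ^ (2 / p - 1) * S2 s := by
    calc 2 * (p - 1) * V
        ≤ 2 * (p - 1) * (S s ^ (2 / p - 1) * ∑ i, u i s ^ (p / 2 - 1) * v i ^ 2) :=
          mul_le_mul_of_nonneg_left h3 (by linarith)
      _ = (2 / p) * S s ^ (2 / p - 1) * (p * (p - 1) * ∑ i, u i s ^ (p / 2 - 1) * v i ^ 2) := by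
          field_simp
      _ ≤ _ := mul_le_mul_of_nonneg_left h2
          (mul_nonneg (by positivity) (Real.rpow_nonneg (Spos s).le _))
  linarith

/-- `|x| ^ p` is not twice differentiable at `0`, so convexity is taken from the smoothed potential
by the pointwise limit `ε → 0`. -/
lemma convexOn_lpPotential_line {p : ℝ} (hp : 1 < p) (hp2 : p < 2) {d : ℕ} (hd : 1 ≤ d)
    (b v : Param d) :
    ConvexOn ℝ Set.univ (fun s : ℝ => lpPotential p (b + s • v) -
      (p - 1) * lpPotential p v * s ^ 2) := by
  have hp0 : 0 < p := by linarith
  have key : ∀ s : ℝ, Filter.Tendsto (fun ε : ℝ =>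
      (∑ i, ((b i + s * v i) ^ 2 + ε) ^ (p / 2)) ^ (2 / p) -
        (p - 1) * (∑ i, |v i| ^ p) ^ (2 / p) * s ^ 2) (nhdsWithin 0 (Set.Ioi 0))
      (nhds (lpPotential p (b + s • v) - (p - 1) * lpPotential p v * s ^ 2)) := fun s => by
    have hc : Continuous (fun ε : ℝ => (∑ i, ((b i + s * v i) ^ 2 + ε) ^ (p / 2)) ^ (2 / p) -
        (p - 1) * (∑ i, |v i| ^ p) ^ (2 / p) * s ^ 2) := by
      refine Continuous.sub (Continuous.rpow_const ?_ fun _ => Or.inr (by positivity))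
        continuous_const
      exact continuous_finsetSum _ fun i _ =>
        Continuous.rpow_const (by fun_prop) fun _ => Or.inr (by positivity)
    have h := (hc.tendsto 0).mono_left (nhdsWithin_le_nhds (s := Set.Ioi 0))
    have e : ∑ i, |(b + s • v) i| ^ p = ∑ i, ((b i + s * v i) ^ 2 + 0) ^ (p / 2) := by
      refine Finset.sum_congr rfl fun i _ => ?_
      rw [add_zero, ← sq_abs, ← Real.rpow_natCast, ← Real.rpow_mul (abs_nonneg _)]
      simp only [PiLp.add_apply, PiLp.smul_apply, smul_eq_mul]
      congr 1
      push_cast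
      ring
    rw [lpPotential_eq, lpPotential_eq, e]
    exact h
  refine ⟨convex_univ, fun x _ y _ a c ha hc hac => ?_⟩
  refine le_of_tendsto_of_tendsto (key _) (((key x).const_mul a).add ((key y).const_mul c)) ?_
  filter_upwards [self_mem_nhdsWithin] with ε hε
  have h := (convexOn_smoothed_line hp hp2 hd (fun i => b i) (fun i => v i) hε).2
    (Set.mem_univ x) (Set.mem_univ y) ha hc hac
  simpa using h

/-- A convex function has slope over `[0, 1]` at least its derivative at `0`. The quadratic
correction has derivative `0` there and equals `(p - 1) ‖a - b‖_p ^ 2` at `1`. -/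
lemma stronglyConvexWrt_lpPotential {p : ℝ} (hp : 1 < p) (hp2 : p < 2) {d : ℕ} (hd : 1 ≤ d) :
    StronglyConvexWrt (lpNorm p) (2 * (p - 1)) (lpPotential p (d := d)) := by
  intro a b
  have hconv := convexOn_lpPotential_line hp hp2 hd b (a - b)
  have hder : HasDerivAt (fun s : ℝ => lpPotential p (b + s • (a - b)) -
      (p - 1) * lpPotential p (a - b) * s ^ 2)
      (inner ℝ (gradient (lpPotential p) b) (a - b)) 0 := by
    exact ((hasDerivAt_line (differentiable_lpPotential hp hp2 d) b (a - b)).sub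
      ((hasDerivAt_pow 2 (0 : ℝ)).const_mul ((p - 1) * lpPotential p (a - b)))).congr_deriv
      (by simp)
  have h := hconv.le_slope_of_hasDerivAt (Set.mem_univ 0) (Set.mem_univ 1) zero_lt_one hder
  simp only [slope_def_field, one_smul, add_sub_cancel, zero_smul, add_zero, sub_zero, one_pow,
    mul_one, div_one, ne_eq, OfNat.ofNat_ne_zero, not_false_eq_true, zero_pow, mul_zero] at h
  unfold bregman
  change 2 * (p - 1) / 2 * lpPotential p (a - b) ≤ _
  linarith

/-! ### Mirror map properties of the potential -/

lemma gradient_lpPotential_zero (p : ℝ) (hp : 1 < p) (d : ℕ) :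
    gradient (lpPotential p (d := d)) 0 = 0 := by
  have h : IsLocalMin (lpPotential p (d := d)) 0 := Filter.Eventually.of_forall fun x => by
    simpa only [lpPotential, lpNorm_zero hp, zero_pow two_ne_zero] using sq_nonneg (lpNorm p x)
  simp [gradient, h.fderiv_eq_zero]

/-- Strong convexity based at the convex combination `m`, applied to both endpoints: the gradient
terms cancel in the weighted sum. -/
lemma strictConvexOn_lpPotential {p : ℝ} (hp : 1 < p) (hp2 : p < 2) {d : ℕ} (hd : 1 ≤ d) :
    StrictConvexOn ℝ Set.univ (lpPotential p (d := d)) := by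
  refine ⟨convex_univ, fun x _ y _ hxy a c ha hc hac => ?_⟩
  set m := a • x + c • y with hm
  have hpos : ∀ z : Param d, z ≠ 0 → 0 < 2 * (p - 1) / 2 * lpNorm p z ^ 2 := fun z hz => by
    have : lpNorm p z ≠ 0 := fun h => hz ((isNorm_lpNorm hp d).eq_zero z h)
    have : 0 < p - 1 := by linarith
    positivity
  have e1 : x - m = c • (x - y) := by
    rw [hm, eq_sub_of_add_eq hac]; module
  have e2 : y - m = (-a) • (x - y) := by
    rw [hm, eq_sub_of_add_eq' hac]; module
  have h1 := stronglyConvexWrt_lpPotential hp hp2 hd x m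
  have h2 := stronglyConvexWrt_lpPotential hp hp2 hd y m
  have h3 := hpos (x - m) (by rw [e1]; exact smul_ne_zero hc.ne' (sub_ne_zero.2 hxy))
  have h4 := hpos (y - m) (by
    rw [e2]; exact smul_ne_zero (neg_ne_zero.2 ha.ne') (sub_ne_zero.2 hxy))
  unfold bregman at h1 h2
  rw [e1, inner_smul_right] at h1
  rw [e2, inner_smul_right] at h2
  rw [e1] at h3
  rw [e2] at h4
  have h5 := mul_lt_mul_of_pos_left (h3.trans_le h1) ha
  have h6 := mul_lt_mul_of_pos_left (h4.trans_le h2) hc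
  simp only [smul_eq_mul]
  have h7 : lpPotential p m = a * lpPotential p m + c * lpPotential p m := by
    rw [← add_mul, hac, one_mul]
  nlinarith

/-- A minimizer of `ψ - ⟨z, ·⟩` has `∇ψ = z`. It exists because `ψ x ≥ ‖x‖ ^ 2 / d` makes this
function coercive. -/
lemma surjective_gradient_lpPotential {p : ℝ} (hp : 1 < p) (hp2 : p < 2) {d : ℕ} (hd : 1 ≤ d) :
    Function.Surjective (gradient (lpPotential p (d := d))) := by
  intro z
  have hψ := differentiable_lpPotential hp hp2 d
  have hd0 : (0 : ℝ) < d := by exact_mod_cast hd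
  have hdf : Differentiable ℝ fun x : Param d => lpPotential p x - inner ℝ z x :=
    hψ.sub (InnerProductSpace.toDual ℝ _ z).differentiable
  have hlim : Filter.Tendsto (fun x : Param d => lpPotential p x - inner ℝ z x)
      (Filter.cocompact _) Filter.atTop := by
    have hlow : ∀ x : Param d, ‖x‖ * ((1 / d) * ‖x‖ - ‖z‖) ≤ lpPotential p x - inner ℝ z x :=
      fun x => by
        have h1 := norm_sq_le_lpNorm_sq hp x
        have h2 := real_inner_le_norm z x
        have h3 : (1 / d) * ‖x‖ ^ 2 ≤ lpNorm p x ^ 2 := by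
          rw [one_div, inv_mul_le_iff₀ hd0]; exact h1
        unfold lpPotential
        nlinarith
    refine Filter.tendsto_atTop_mono hlow ?_
    have hn := tendsto_norm_cocompact_atTop (E := Param d)
    refine hn.atTop_mul_atTop₀ ?_
    exact Filter.tendsto_atTop_add_const_right _ _ (hn.const_mul_atTop (by positivity))
  obtain ⟨x, hx⟩ := hdf.continuous.exists_forall_le hlim
  refine ⟨x, ?_⟩
  have hmin : IsLocalMin (fun x : Param d => lpPotential p x - inner ℝ z x) x :=
    Filter.Eventually.of_forall hx
  have hg : HasGradientAt (fun x : Param d => lpPotential p x - inner ℝ z x)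
      (gradient (lpPotential p) x - z) x := by
    rw [hasGradientAt_iff_hasFDerivAt, map_sub]
    refine (hψ x).hasGradientAt.hasFDerivAt.sub ?_
    exact (InnerProductSpace.toDual ℝ _ z).hasFDerivAt
  have h0 := hmin.hasFDerivAt_eq_zero hg.hasFDerivAt
  rw [LinearIsometryEquiv.map_eq_zero_iff] at h0
  exact sub_eq_zero.1 h0

lemma isMirrorMap_lpPotential {p : ℝ} (hp : 1 < p) (hp2 : p < 2) {d : ℕ} (hd : 1 ≤ d) :
    IsMirrorMap (lpPotential p (d := d)) where
  differentiable := differentiable_lpPotential hp hp2 d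
  strictConvex := strictConvexOn_lpPotential hp hp2 hd
  surjective := surjective_gradient_lpPotential hp hp2 hd

lemma sqrt_lpPotential (p : ℝ) {d : ℕ} (α : Param d) :
    Real.sqrt (lpPotential p α) = lpNorm p α :=
  Real.sqrt_sq (lpNorm_nonneg p α)

lemma discreteAssumption_lpPotential {p : ℝ} (hp : 1 < p) (hp2 : p < 2) {d : ℕ} (hd : 1 ≤ d)
    {τ : ℝ} (hτ : 0 < τ) :
    DiscreteAssumption (lpBall p d) τ (lpNorm p) (2 * (p - 1)) 1 1 (lpPotential p) where
  nonneg α := sq_nonneg _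
  differentiable := differentiable_lpPotential hp hp2 d
  gradient_zero := gradient_lpPotential_zero p hp d
  sqrt_convex := by
    simp only [sqrt_lpPotential]
    refine ⟨convex_univ, fun x _ y _ a c ha hc _ => ?_⟩
    refine (lpNorm_add_le hp _ _).trans ?_
    rw [lpNorm_smul hp, lpNorm_smul hp, abs_of_nonneg ha, abs_of_nonneg hc]
    rfl
  isNorm := isNorm_lpNorm hp d
  rho_pos := by linarith
  stronglyConvex := stronglyConvexWrt_lpPotential hp hp2 hd
  cl_pos := one_pos
  cu_pos := one_pos
  gauge_le α := by rw [sqrt_lpPotential, one_mul]; exact gauge_lpBall_le hp α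
  sqrt_le α hα := by
    rw [sqrt_lpPotential, one_mul]; exact lpNorm_le_of_mem_smul_lpBall hp hτ.le hα

/-- Euler's identity for a function homogeneous of degree two. -/
lemma inner_gradient_lpPotential_self {p : ℝ} (hp : 1 < p) (hp2 : p < 2) {d : ℕ} (a : Param d) :
    inner ℝ (gradient (lpPotential p) a) a = 2 * lpPotential p a := by
  have h1 := hasDerivAt_line (differentiable_lpPotential hp hp2 d) a a
  have h2 : HasDerivAt (fun s : ℝ => (1 + s) ^ 2 * lpPotential p a) (2 * lpPotential p a) 0 := by
    have := (((hasDerivAt_id (0 : ℝ)).const_add 1).pow 2).mul_const (lpPotential p a)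
    simpa using this
  refine h1.unique (h2.congr_of_eventuallyEq (Filter.Eventually.of_forall fun s => ?_))
  have : a + s • a = (1 + s) • a := by module
  simp only [this, lpPotential, lpNorm_smul hp, mul_pow, sq_abs]

lemma bregman_lpPotential_nonneg {p : ℝ} (hp : 1 < p) (hp2 : p < 2) {d : ℕ} (hd : 1 ≤ d)
    (a b : Param d) : 0 ≤ bregman (lpPotential p) a b := by
  refine le_trans ?_ (stronglyConvexWrt_lpPotential hp hp2 hd a b)
  have : 0 < p - 1 := by linarith
  positivity

/-- This keeps the bound on the iterates free of the factor `1 / (p - 1)` that strong convexity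
would bring. Nonnegativity of `D(c • a, b)` is a quadratic inequality in `c`; its discriminant gives
`⟨∇ψ(b), a⟩ ≤ 2 ‖a‖_p ‖b‖_p`. -/
lemma sq_lpNorm_sub_le_bregman {p : ℝ} (hp : 1 < p) (hp2 : p < 2) {d : ℕ} (hd : 1 ≤ d)
    (a b : Param d) : (lpNorm p a - lpNorm p b) ^ 2 ≤ bregman (lpPotential p) a b := by
  have hself := inner_gradient_lpPotential_self hp hp2 b
  set g := inner ℝ (gradient (lpPotential p) b) a with hg
  have hquad : ∀ c : ℝ, 0 ≤ lpNorm p a ^ 2 * (c * c) + (-g) * c + lpNorm p b ^ 2 := fun c => by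
    have h := bregman_lpPotential_nonneg hp hp2 hd (c • a) b
    unfold bregman at h
    rw [inner_sub_right, inner_smul_right, hself, ← hg] at h
    simp only [lpPotential, lpNorm_smul hp, mul_pow, sq_abs] at h
    nlinarith
  have hdisc := discrim_le_zero hquad
  unfold discrim at hdisc
  have hgle : g ≤ 2 * (lpNorm p a * lpNorm p b) := by
    refine le_of_sq_le_sq ?_ (mul_nonneg zero_le_two
      (mul_nonneg (lpNorm_nonneg p a) (lpNorm_nonneg p b)))
    nlinarith
  unfold bregman
  rw [inner_sub_right, hself, ← hg]
  simp only [lpPotential]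
  nlinarith

lemma bregman_lpPotential_zero {p : ℝ} (hp : 1 < p) {d : ℕ} (a : Param d) :
    bregman (lpPotential p) a 0 = lpNorm p a ^ 2 := by
  simp [bregman, gradient_lpPotential_zero p hp, lpPotential, lpNorm_zero hp]

/-! ### Quadratic expansions of the risks -/

lemma sqNorm_eq_dotProduct {n : ℕ} (v : Fin n → ℝ) : sqNorm v = v ⬝ᵥ v := by
  rw [sqNorm, EuclideanSpace.norm_sq_eq]
  simp [dotProduct, sq]

lemma sqNorm_nonneg {n : ℕ} (v : Fin n → ℝ) : 0 ≤ sqNorm v := sq_nonneg _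

lemma sqNorm_add {n : ℕ} (v w : Fin n → ℝ) :
    sqNorm (v + w) = sqNorm v + 2 * (v ⬝ᵥ w) + sqNorm w := by
  simp only [sqNorm_eq_dotProduct, add_dotProduct, dotProduct_add, dotProduct_comm w v]
  ring

lemma sqNorm_smul {n : ℕ} (c : ℝ) (v : Fin n → ℝ) : sqNorm (c • v) = c ^ 2 * sqNorm v := by
  simp only [sqNorm_eq_dotProduct, smul_dotProduct, dotProduct_smul, smul_eq_mul]
  ring

lemma sqNorm_sub {n : ℕ} (v w : Fin n → ℝ) :
    sqNorm (v - w) = sqNorm v - 2 * (v ⬝ᵥ w) + sqNorm w := by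
  simp only [sqNorm_eq_dotProduct, sub_dotProduct, dotProduct_sub, dotProduct_comm w v]
  ring

lemma differentiable_empiricalRisk {n d : ℕ} (X : Matrix (Fin n) (Fin d) ℝ) (y : Fin n → ℝ) :
    Differentiable ℝ (empiricalRisk X y) := by
  have h : empiricalRisk X y = fun α : Param d =>
      (1 / (n : ℝ)) * ∑ i, ((∑ j, X i j * α j) - y i) ^ 2 := by
    ext α
    simp [empiricalRisk, sqNorm, EuclideanSpace.norm_sq_eq, Matrix.mulVec, dotProduct]
  rw [h]
  fun_prop

/-- Along a line the risk is an exact quadratic, and uniqueness of the derivative identifies the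
linear coefficient, so the gradient need not be computed. -/
lemma empiricalRisk_add {n d : ℕ} (X : Matrix (Fin n) (Fin d) ℝ) (y : Fin n → ℝ)
    (b v : Param d) :
    empiricalRisk X y (b + v) = empiricalRisk X y b + inner ℝ (gradient (empiricalRisk X y) b) v +
      (1 / (n : ℝ)) * sqNorm (X.mulVec v.ofLp) := by
  have hexp : ∀ s : ℝ, empiricalRisk X y (b + s • v) = empiricalRisk X y b +
      s * ((1 / (n : ℝ)) * (2 * ((X.mulVec b.ofLp - y) ⬝ᵥ X.mulVec v.ofLp))) +
      s ^ 2 * ((1 / (n : ℝ)) * sqNorm (X.mulVec v.ofLp)) := fun s => by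
    have : X.mulVec (b + s • v).ofLp - y = (X.mulVec b.ofLp - y) + s • X.mulVec v.ofLp := by
      rw [WithLp.ofLp_add, WithLp.ofLp_smul, Matrix.mulVec_add, Matrix.mulVec_smul]
      abel
    unfold empiricalRisk
    rw [this, sqNorm_add, sqNorm_smul, dotProduct_smul, smul_eq_mul]
    ring
  have h1 := hasDerivAt_line (differentiable_empiricalRisk X y) b v
  have h2 : HasDerivAt (fun s : ℝ => empiricalRisk X y (b + s • v))
      ((1 / (n : ℝ)) * (2 * ((X.mulVec b.ofLp - y) ⬝ᵥ X.mulVec v.ofLp))) 0 := by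
    simp only [hexp]
    exact ((((hasDerivAt_id (0 : ℝ)).mul_const _).const_add _).add
      ((hasDerivAt_pow 2 (0 : ℝ)).mul_const _)).congr_deriv (by simp)
  have := hexp 1
  rw [one_smul] at this
  rw [this, h1.unique h2]
  ring

lemma empiricalRisk_response_self {n d : ℕ} (X : Matrix (Fin n) (Fin d) ℝ) (αs : Param d)
    (ξ : Fin n → ℝ) :
    empiricalRisk X (response X αs ξ) αs = (1 / (n : ℝ)) * sqNorm ξ := by
  have h : X.mulVec αs.ofLp - (X.mulVec αs.ofLp + ξ) = (-1 : ℝ) • ξ := by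
    rw [neg_one_smul]; abel
  simp only [empiricalRisk, response, h, sqNorm_smul]
  ring

lemma empiricalRisk_response {n d : ℕ} (X : Matrix (Fin n) (Fin d) ℝ) (αs α : Param d)
    (ξ : Fin n → ℝ) :
    empiricalRisk X (response X αs ξ) α = empiricalRisk X (response X αs ξ) αs +
      inSampleRisk X αs α - (1 / (n : ℝ)) * (2 * (ξ ⬝ᵥ X.mulVec (α - αs).ofLp)) := by
  have h : X.mulVec α.ofLp - (X.mulVec αs.ofLp + ξ) = X.mulVec (α - αs).ofLp - ξ := by
    rw [WithLp.ofLp_sub, Matrix.mulVec_sub]; abel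
  rw [empiricalRisk_response_self]
  simp only [empiricalRisk, response, h, inSampleRisk, sqNorm_sub, dotProduct_comm _ ξ]
  ring

lemma empiricalRisk_nonneg {n d : ℕ} (X : Matrix (Fin n) (Fin d) ℝ) (y : Fin n → ℝ)
    (α : Param d) : 0 ≤ empiricalRisk X y α :=
  mul_nonneg (by positivity) (sqNorm_nonneg _)

lemma inSampleRisk_nonneg {n d : ℕ} (X : Matrix (Fin n) (Fin d) ℝ) (αs α : Param d) :
    0 ≤ inSampleRisk X αs α :=
  mul_nonneg (by positivity) (sqNorm_nonneg _)

/-! ### The mirror descent potential argument -/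

/-- By the three-point identity, `D(a, b') = D(a, b) - D(b', b) + η ⟨g, a - b'⟩`. Split `a - b'` at
`b`: the exact expansion handles `a - b` and yields the in-sample risk centred at `a`, smoothness
handles `b' - b`, and `D(b', b)` absorbs the smoothness error because `η β ≤ ρ`. -/
lemma bregman_step_le {n d : ℕ} {X : Matrix (Fin n) (Fin d) ℝ} {ψ N : Param d → ℝ} {ρ β η : ℝ}
    (hsc : StronglyConvexWrt N ρ ψ) (hη : 0 < η) (hβ : 0 < β) (hηρ : η ≤ ρ / β)
    {y : Fin n → ℝ} (hsm : SmoothWrt N β (empiricalRisk X y)) {b b' : Param d}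
    (hstep : gradient ψ b' = gradient ψ b - η • gradient (empiricalRisk X y) b) (a : Param d) :
    bregman ψ a b' ≤ bregman ψ a b +
      η * (empiricalRisk X y a - empiricalRisk X y b' - inSampleRisk X a b) := by
  set g := gradient (empiricalRisk X y) b with hg
  have h1 := hsc b' b
  have h2 := hsm b' b
  have h3 := empiricalRisk_add X y b (a - b)
  rw [add_sub_cancel, ← hg] at h3
  have h4 : sqNorm (X.mulVec (a - b).ofLp) = sqNorm (X.mulVec (b - a).ofLp) := by
    rw [show a - b = (-1 : ℝ) • (b - a) by rw [neg_one_smul, neg_sub], WithLp.ofLp_smul,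
      Matrix.mulVec_smul, sqNorm_smul]
    ring
  rw [h4] at h3
  have h5 : η * β ≤ ρ := (le_div_iff₀ hβ).1 hηρ
  have h6 : η * β / 2 * N (b' - b) ^ 2 ≤ ρ / 2 * N (b' - b) ^ 2 :=
    mul_le_mul_of_nonneg_right (by linarith) (sq_nonneg _)
  have h7 := mul_le_mul_of_nonneg_left h2 hη.le
  have e1 : inner ℝ g (a - b) = inner ℝ g (a - b') + inner ℝ g (b' - b) := by
    rw [← inner_add_right]; congr 1; abel
  have e2 : inner ℝ (gradient ψ b) (a - b) =
      inner ℝ (gradient ψ b) (a - b') + inner ℝ (gradient ψ b) (b' - b) := by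
    rw [← inner_add_right]; congr 1; abel
  unfold bregman at h1 ⊢
  rw [hstep, inner_sub_left, inner_smul_left, e2]
  simp only [RCLike.conj_to_real]
  unfold inSampleRisk
  rw [h3, e1]
  rw [← hg] at h7
  linarith

/-- If the noise has squared norm at most `2n` and the offset process is at most `z` on the
`ℓ_p` ball of radius `(2 + √2) τ`, then optimally stopped mirror descent has risk at most
`ε + z`. -/
lemma lpESMDRiskLE_of_offset {p τ ε z : ℝ} (hp : 1 < p) (hp2 : p < 2) {n d : ℕ} (hn : 1 ≤ n)
    (hd : 1 ≤ d) (hτ : 0 < τ) (hε : 0 < ε) (hz : 0 ≤ z) {X : Matrix (Fin n) (Fin d) ℝ}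
    {ξ : Fin n → ℝ} (hξ : sqNorm ξ ≤ 2 * n)
    (hoff : ∀ Δ : Param d, lpNorm p Δ ≤ (2 + Real.sqrt 2) * τ →
      2 * (ξ ⬝ᵥ X.mulVec Δ.ofLp) - sqNorm (X.mulVec Δ.ofLp) ≤ n * z) :
    LpESMDRiskLE p τ ε (ε + z) X ξ := by
  intro αs hαs β η hadm α hmd
  have hn0 : (0 : ℝ) < n := by exact_mod_cast hn
  have hαs' : lpNorm p αs ≤ τ := lpNorm_le_of_mem_smul_lpBall hp hτ.le hαs
  set T := horizon 1 τ ε η with hT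
  suffices h : ∃ t ≤ T, inSampleRisk X αs (α t) ≤ ε + z by
    obtain ⟨t, htT, ht⟩ := h
    exact (Finset.inf'_le (fun t => inSampleRisk X αs (α t))
      (Finset.mem_range.2 (Nat.lt_succ_of_le htT))).trans ht
  by_cases h0 : αs = 0
  -- For `α⋆ = 0` the starting point already has zero risk; the cap on `η` by the divergence is not
  -- available here.
  · refine ⟨0, Nat.zero_le _, ?_⟩
    rw [hmd.1, h0]
    simp [inSampleRisk, sqNorm]
    positivity
  set y := response X αs ξ with hy
  have hη := hadm.eta_pos
  have hD0 : bregman (lpPotential p) αs (α 0) = lpNorm p αs ^ 2 := by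
    rw [hmd.1, bregman_lpPotential_zero hp]
  have hD0τ : lpNorm p αs ^ 2 ≤ τ ^ 2 := pow_le_pow_left₀ (lpNorm_nonneg p αs) hαs' 2
  have hstep : ∀ t, bregman (lpPotential p) αs (α (t + 1)) ≤ bregman (lpPotential p) αs (α t) +
      η * (empiricalRisk X y αs - empiricalRisk X y (α (t + 1)) - inSampleRisk X αs (α t)) :=
    fun t => bregman_step_le (stronglyConvexWrt_lpPotential hp hp2 hd) hη hadm.beta_pos
      hadm.eta_le (hadm.smooth y) (hmd.2 t) αs
  -- Each step at which `P` fails lowers the divergence by more than `η ε`.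
  set P : ℕ → Prop := fun t =>
    inSampleRisk X αs (α t) + empiricalRisk X y (α (t + 1)) - empiricalRisk X y αs ≤ ε with hP
  have hdec : ∀ t, (∀ s < t, ¬ P s) →
      bregman (lpPotential p) αs (α t) ≤ lpNorm p αs ^ 2 - t * (η * ε) := by
    intro t
    induction t with
    | zero => intro _; simp [hD0]
    | succ t ih =>
      intro h
      have h1 := ih fun s hs => h s (hs.trans (Nat.lt_succ_self t))
      have h2 : ε < _ := not_le.1 (h t (Nat.lt_succ_self t))
      have h3 := mul_lt_mul_of_pos_left h2 hη
      have h4 := hstep t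
      push_cast
      linarith
  -- The horizon exceeds what the initial divergence, at most `τ ^ 2`, can pay for if `P` keeps
  -- failing.
  have hTle : 2 * τ ^ 2 ≤ T * (η * ε) := by
    have h1 : 2 * (1 : ℝ) ^ 2 * τ ^ 2 / (ε * η) ≤ T := Nat.le_ceil _
    rw [div_le_iff₀ (by positivity)] at h1
    linarith
  have hex : ∃ t < T, P t := by
    by_contra! h
    have h1 := hdec T h
    have h2 := bregman_lpPotential_nonneg hp hp2 hd αs (α T)
    have : 0 < τ ^ 2 := by positivity
    linarith
  obtain ⟨t, htT, htP, htmin⟩ : ∃ t < T, P t ∧ ∀ s < t, ¬ P s := by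
    classical
    obtain ⟨t, htT, htP⟩ := hex
    exact ⟨Nat.find ⟨t, htP⟩, (Nat.find_le htP).trans_lt htT, Nat.find_spec ⟨t, htP⟩,
      fun s hs => Nat.find_min _ hs⟩
  refine ⟨t, htT.le, ?_⟩
  have hDt : bregman (lpPotential p) αs (α t) ≤ lpNorm p αs ^ 2 := by
    have := hdec t htmin
    have : 0 ≤ t * (η * ε) := by positivity
    linarith
  have hRs : empiricalRisk X y αs ≤ 2 := by
    rw [hy, empiricalRisk_response_self, one_div, inv_mul_le_iff₀ hn0]
    linarith
  have hη2 : 2 * η ≤ lpNorm p αs ^ 2 := by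
    have := hadm.eta_le_bregman h0
    rw [bregman_lpPotential_zero hp] at this
    linarith
  -- One further step may raise the divergence, but by at most `2 η ≤ ‖α⋆‖_p ^ 2`, since `R_n(α⋆) ≤
  -- 2` and the other two terms have a favourable sign.
  have hDt1 : bregman (lpPotential p) αs (α (t + 1)) ≤ 2 * τ ^ 2 := by
    have h1 := hstep t
    have h2 : η * (empiricalRisk X y αs - empiricalRisk X y (α (t + 1)) -
        inSampleRisk X αs (α t)) ≤ η * 2 := by
      refine mul_le_mul_of_nonneg_left ?_ hη.le
      have := empiricalRisk_nonneg X y (α (t + 1))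
      have := inSampleRisk_nonneg X αs (α t)
      linarith
    linarith
  have hnorm : lpNorm p (α (t + 1)) ≤ (1 + Real.sqrt 2) * τ := by
    have h1 := (sq_lpNorm_sub_le_bregman hp hp2 hd αs (α (t + 1))).trans hDt1
    have h2 : |lpNorm p αs - lpNorm p (α (t + 1))| ≤ Real.sqrt 2 * τ := by
      refine abs_le_of_sq_le_sq ?_ (by positivity)
      rw [mul_pow, Real.sq_sqrt zero_le_two]
      exact h1
    have := (abs_le.1 h2).1
    linarith
  have hΔ : lpNorm p (α (t + 1) - αs) ≤ (2 + Real.sqrt 2) * τ := by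
    have := lpNorm_sub_le hp (α (t + 1)) αs
    linarith
  -- The offset is evaluated at `α (t + 1)` and gives `R_n(α_{t+1}) - R_n(α⋆) ≥ -z`; with `P t` this
  -- bounds the risk of `α t`.
  have h1 := hoff _ hΔ
  have h2 := empiricalRisk_response X αs (α (t + 1)) ξ
  rw [← hy] at h2
  have h3 : (1 / (n : ℝ)) * (2 * (ξ ⬝ᵥ X.mulVec (α (t + 1) - αs).ofLp) -
      sqNorm (X.mulVec (α (t + 1) - αs).ofLp)) ≤ z := by
    rw [one_div, inv_mul_le_iff₀ hn0]; exact h1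
  have h4 : inSampleRisk X αs (α (t + 1)) =
    (1 / (n : ℝ)) * sqNorm (X.mulVec (α (t + 1) - αs).ofLp) := rfl
  have h5 : inSampleRisk X αs (α t) + empiricalRisk X y (α (t + 1)) - empiricalRisk X y αs ≤ ε :=
    htP
  linarith

/-! ### Exponential moments and tails -/

/-- `S` need not be measurable (in the application it is an uncountable intersection); covering its
failures by two measurable sets suffices. -/
lemma withProbAtLeast_of_bad_sets {Ω : Type*} [MeasurableSpace Ω] {μ : Measure Ω}
    [IsProbabilityMeasure μ] {c c₁ c₂ : ℝ} {S A B : Set Ω} (hA : MeasurableSet A)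
    (hB : MeasurableSet B) (hA' : μ.real A ≤ c₁) (hB' : μ.real B ≤ c₂) (hc : c ≤ 1 - c₁ - c₂)
    (hS : ∀ ω, ω ∉ A → ω ∉ B → ω ∈ S) : WithProbAtLeast μ c S := by
  refine ⟨(A ∪ B)ᶜ, (hA.union hB).compl, fun ω hω => ?_, ?_⟩
  · simp only [Set.mem_compl_iff, Set.mem_union, not_or] at hω
    exact hS ω hω.1 hω.2
  · rw [probReal_compl_eq_one_sub (hA.union hB)]
    have := measureReal_union_le (μ := μ) A B
    linarith

lemma measureReal_lt_le_of_lintegral {Ω : Type*} [MeasurableSpace Ω] {μ : Measure Ω}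
    {f : Ω → ℝ} (hf : Measurable f) {A t : ℝ} (hA : 0 ≤ A) (ht : 0 < t)
    (h : ∫⁻ ω, ENNReal.ofReal (f ω) ∂μ ≤ ENNReal.ofReal A) :
    μ.real {ω | t < f ω} ≤ A / t := by
  have h1 := mul_meas_ge_le_lintegral (μ := μ) hf.ennreal_ofReal (ENNReal.ofReal t)
  have h2 : μ {ω | t < f ω} ≤ μ {ω | ENNReal.ofReal t ≤ ENNReal.ofReal (f ω)} :=
    measure_mono fun ω hω => ENNReal.ofReal_le_ofReal (le_of_lt hω)
  have h3 : ENNReal.ofReal t * μ {ω | t < f ω} ≤ ENNReal.ofReal A :=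
    (mul_le_mul_right h2 _).trans (h1.trans h)
  have h4 := ENNReal.toReal_mono ENNReal.ofReal_ne_top h3
  rw [ENNReal.toReal_mul, ENNReal.toReal_ofReal ht.le, ENNReal.toReal_ofReal hA] at h4
  rw [le_div_iff₀ ht, mul_comm]
  exact h4

lemma measureReal_lt_le_of_lintegral_exp {Ω : Type*} [MeasurableSpace Ω] {μ : Measure Ω}
    {f : Ω → ℝ} (hf : Measurable f) {A t : ℝ} (hA : 0 ≤ A)
    (h : ∫⁻ ω, ENNReal.ofReal (Real.exp (f ω)) ∂μ ≤ ENNReal.ofReal A) :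
    μ.real {ω | t < f ω} ≤ A * Real.exp (-t) := by
  have := measureReal_lt_le_of_lintegral (Real.measurable_exp.comp hf) hA (Real.exp_pos t) h
  rw [Real.exp_neg]
  simpa [div_eq_mul_inv] using this

instance (n : ℕ) : IsProbabilityMeasure (noiseLaw n) := by
  unfold noiseLaw; infer_instance

instance (n d : ℕ) : IsProbabilityMeasure (designLaw n d) := by
  unfold designLaw; infer_instance

@[fun_prop]
lemma measurable_dotProduct_left {n : ℕ} (w : Fin n → ℝ) :
    Measurable fun ξ : Fin n → ℝ => ξ ⬝ᵥ w := by
  unfold dotProduct; fun_prop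

@[fun_prop]
lemma measurable_dotProduct_self {n : ℕ} :
    Measurable fun ξ : Fin n → ℝ => ξ ⬝ᵥ ξ := by
  unfold dotProduct; fun_prop

lemma lintegral_noiseLaw_prod {n : ℕ} (f : Fin n → ℝ → ℝ) (hf0 : ∀ i x, 0 ≤ f i x)
    (hf : ∀ i, Integrable (f i) (gaussianReal 0 1)) :
    ∫⁻ ξ, ENNReal.ofReal (∏ i, f i (ξ i)) ∂(noiseLaw n) =
      ENNReal.ofReal (∏ i, ∫ x, f i x ∂(gaussianReal 0 1)) := by
  unfold noiseLaw
  rw [← integral_fintype_prod_eq_prod, ofReal_integral_eq_lintegral_ofReal]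
  · exact Integrable.fintype_prod hf
  · exact Filter.Eventually.of_forall fun ξ => Finset.prod_nonneg fun i _ => hf0 i _

lemma lintegral_exp_dotProduct {n : ℕ} (w : Fin n → ℝ) :
    ∫⁻ ξ, ENNReal.ofReal (Real.exp (ξ ⬝ᵥ w)) ∂(noiseLaw n) =
      ENNReal.ofReal (Real.exp ((w ⬝ᵥ w) / 2)) := by
  have h := lintegral_noiseLaw_prod (n := n) (fun i x => Real.exp (w i * x))
    (fun i x => (Real.exp_pos _).le) (fun i => integrable_exp_mul_gaussianReal (w i))
  have e : ∀ i, ∫ x, Real.exp (w i * x) ∂(gaussianReal 0 1) = Real.exp (w i * w i / 2) :=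
    fun i => by
      have := congrFun (mgf_fun_id_gaussianReal (μ := 0) (v := 1)) (w i)
      simpa [mgf, sq] using this
  simp only [e, ← Real.exp_sum] at h
  simpa [dotProduct, mul_comm, Finset.sum_div] using h

lemma integrable_integral_exp_sq_gaussianReal :
    Integrable (fun x : ℝ => Real.exp (x ^ 2 / 4)) (gaussianReal 0 1) ∧
      ∫ x, Real.exp (x ^ 2 / 4) ∂(gaussianReal 0 1) = Real.sqrt 2 := by
  have hpdf : ∀ x : ℝ, gaussianPDFReal 0 1 x * Real.exp (x ^ 2 / 4) =
      (Real.sqrt (2 * Real.pi))⁻¹ * Real.exp (-(1 / 4) * x ^ 2) := fun x => by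
    simp only [gaussianPDFReal, NNReal.coe_one, mul_one, sub_zero]
    rw [mul_assoc, ← Real.exp_add]
    congr 2
    ring
  constructor
  · rw [gaussianReal_of_var_ne_zero 0 one_ne_zero,
      integrable_withDensity_iff (measurable_gaussianPDF 0 1)
        (Filter.Eventually.of_forall fun x => ENNReal.ofReal_lt_top)]
    have : (fun x : ℝ => Real.exp (x ^ 2 / 4) * (gaussianPDF 0 1 x).toReal) =
        fun x => (Real.sqrt (2 * Real.pi))⁻¹ * Real.exp (-(1 / 4) * x ^ 2) := by
      ext x
      rw [gaussianPDF, ENNReal.toReal_ofReal (gaussianPDFReal_nonneg 0 1 x), mul_comm, hpdf]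
    rw [this]
    exact (integrable_exp_neg_mul_sq (by norm_num)).const_mul _
  · rw [integral_gaussianReal_eq_integral_smul one_ne_zero]
    simp only [smul_eq_mul, hpdf]
    rw [integral_const_mul, integral_gaussian, ← Real.sqrt_inv,
      ← Real.sqrt_mul (by positivity)]
    congr 1
    field_simp
    norm_num

lemma lintegral_exp_sq {n : ℕ} :
    ∫⁻ ξ, ENNReal.ofReal (Real.exp ((ξ ⬝ᵥ ξ) / 4)) ∂(noiseLaw n) =
      ENNReal.ofReal (Real.sqrt 2 ^ n) := by
  have h := lintegral_noiseLaw_prod (n := n) (fun _ x => Real.exp (x ^ 2 / 4))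
    (fun i x => (Real.exp_pos _).le) (fun i => integrable_integral_exp_sq_gaussianReal.1)
  simp only [integrable_integral_exp_sq_gaussianReal.2, ← Real.exp_sum] at h
  simpa [dotProduct, sq, Finset.sum_div] using h

/-- Gaussian linearization: if `h ↦ ∑ h k • u k` is a contraction then the quadratic form
`∑ k, ⟨ξ, u k⟩²` has a controlled exponential moment. -/
lemma lintegral_exp_sum_sq_le {n r : ℕ} (u : Fin r → Fin n → ℝ)
    (hu : ∀ h : Fin r → ℝ, (∑ k, h k • u k) ⬝ᵥ (∑ k, h k • u k) ≤ h ⬝ᵥ h) :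
    ∫⁻ ξ, ENNReal.ofReal (Real.exp ((∑ k, (ξ ⬝ᵥ u k) ^ 2) / 4)) ∂(noiseLaw n) ≤
      ENNReal.ofReal (Real.sqrt 2 ^ r) := by
  have h2 : (Real.sqrt 2)⁻¹ * (Real.sqrt 2)⁻¹ = 1 / 2 := by
    rw [← mul_inv, Real.mul_self_sqrt zero_le_two, one_div]
  -- `exp (s ^ 2 / 4)` is the mean of `exp (h s / √2)` over a standard Gaussian `h`. After
  -- exchanging integrals the exponent is linear in `ξ`, and integrating out `ξ` leaves a moment of
  -- `h`.
  have e1 : ∀ ξ : Fin n → ℝ, ENNReal.ofReal (Real.exp ((∑ k, (ξ ⬝ᵥ u k) ^ 2) / 4)) =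
      ∫⁻ h, ENNReal.ofReal (Real.exp (h ⬝ᵥ fun k => (Real.sqrt 2)⁻¹ * (ξ ⬝ᵥ u k)))
        ∂(noiseLaw r) := fun ξ => by
    rw [lintegral_exp_dotProduct]
    congr 2
    have : ((fun k => (Real.sqrt 2)⁻¹ * (ξ ⬝ᵥ u k)) ⬝ᵥ
        fun k => (Real.sqrt 2)⁻¹ * (ξ ⬝ᵥ u k)) = (1 / 2) * ∑ k, (ξ ⬝ᵥ u k) ^ 2 := by
      rw [dotProduct, Finset.mul_sum]
      refine Finset.sum_congr rfl fun k _ => ?_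
      rw [← h2]; ring
    rw [this]; ring
  have e2 : ∀ (ξ : Fin n → ℝ) (h : Fin r → ℝ),
      (h ⬝ᵥ fun k => (Real.sqrt 2)⁻¹ * (ξ ⬝ᵥ u k)) =
        ξ ⬝ᵥ ((Real.sqrt 2)⁻¹ • ∑ k, h k • u k) := fun ξ h => by
    rw [dotProduct_smul, dotProduct_sum, smul_eq_mul, Finset.mul_sum, dotProduct]
    refine Finset.sum_congr rfl fun k _ => ?_
    rw [dotProduct_smul, smul_eq_mul]; ring
  simp only [e1]
  rw [lintegral_lintegral_swap]
  · simp only [e2, lintegral_exp_dotProduct]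
    rw [← lintegral_exp_sq]
    refine lintegral_mono fun h => ENNReal.ofReal_le_ofReal (Real.exp_le_exp.2 ?_)
    rw [smul_dotProduct, dotProduct_smul, smul_eq_mul, smul_eq_mul, ← mul_assoc, h2]
    linarith [hu h]
  · refine Measurable.aemeasurable ?_
    unfold Function.uncurry dotProduct
    fun_prop

lemma measureReal_two_mul_lt_sqNorm_le (n : ℕ) :
    (noiseLaw n).real {ξ | 2 * (n : ℝ) < sqNorm ξ} ≤ Real.exp (-0.1 * n) := by
  have h := measureReal_lt_le_of_lintegral_exp (μ := noiseLaw n)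
    (f := fun ξ => (ξ ⬝ᵥ ξ) / 4) (t := n / 2) (measurable_dotProduct_self.div_const 4)
    (by positivity) lintegral_exp_sq.le
  have e : {ξ : Fin n → ℝ | 2 * (n : ℝ) < sqNorm ξ} = {ξ | (n : ℝ) / 2 < (ξ ⬝ᵥ ξ) / 4} := by
    ext ξ
    simp only [Set.mem_ofPred_eq, sqNorm_eq_dotProduct]
    constructor <;> intro h <;> linarith
  rw [e]
  refine h.trans ?_
  -- It suffices that `log 2 ≤ 4 / 5`; the final rate is `2 / 5 - 1 / 2 = -0.1`.
  have h2 : Real.sqrt 2 ≤ Real.exp (2 / 5) := by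
    rw [Real.sqrt_le_left (Real.exp_pos _).le, ← Real.exp_nat_mul, ← Real.log_le_iff_le_exp two_pos]
    have := Real.log_two_lt_d9
    push_cast
    linarith
  calc Real.sqrt 2 ^ n * Real.exp (-(n / 2)) ≤ Real.exp (2 / 5) ^ n * Real.exp (-(n / 2)) := by
        gcongr
    _ = Real.exp (-0.1 * n) := by
        rw [← Real.exp_nat_mul, ← Real.exp_add]; congr 1; ring

lemma measurable_sqNorm {n : ℕ} : Measurable (sqNorm (n := n)) := by
  have : sqNorm (n := n) = fun ξ => ξ ⬝ᵥ ξ := funext sqNorm_eq_dotProduct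
  rw [this]; fun_prop

/-! ### The one-dimensional tail -/

/-- The density is at least `0.39 (1 - x ^ 2 / 2)`, whose integral `0.39 (2 m - m ^ 3 / 3)` is at
least `0.65 m` for `m ≤ 1`. -/
lemma integral_gaussianPDFReal_Icc_ge {m : ℝ} (hm : 0 ≤ m) (hm1 : m ≤ 1) :
    m * (65 / 100) ≤ (gaussianReal 0 1).real (Set.Icc (-m) m) := by
  have hs : (0.39 : ℝ) ≤ (Real.sqrt (2 * Real.pi))⁻¹ := by
    rw [le_inv_comm₀ (by norm_num) (by positivity), Real.sqrt_le_left (by norm_num)]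
    have := Real.pi_lt_d2
    norm_num
    linarith
  have hlow : ∀ x : ℝ, 0.39 * (1 - x ^ 2 / 2) ≤ gaussianPDFReal 0 1 x := fun x => by
    simp only [gaussianPDFReal, NNReal.coe_one, mul_one, sub_zero]
    have h1 := Real.add_one_le_exp (-x ^ 2 / 2)
    have h2 := Real.exp_pos (-x ^ 2 / 2)
    calc 0.39 * (1 - x ^ 2 / 2) ≤ 0.39 * Real.exp (-x ^ 2 / 2) := by linarith
      _ ≤ _ := mul_le_mul_of_nonneg_right hs h2.le
  have hle : -m ≤ m := by linarith
  have h1 : ∫ x in (-m)..m, 0.39 * (1 - x ^ 2 / 2) ≤ ∫ x in (-m)..m, gaussianPDFReal 0 1 x :=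
    intervalIntegral.integral_mono_on hle
      (Continuous.intervalIntegrable (by fun_prop) _ _)
      ((integrable_gaussianPDFReal 0 1).intervalIntegrable) fun x _ => hlow x
  have h2 : ∫ x in (-m)..m, 0.39 * (1 - x ^ 2 / 2) = 0.39 * (2 * m - m ^ 3 / 3) := by
    rw [intervalIntegral.integral_const_mul, intervalIntegral.integral_sub (by simp)
      (Continuous.intervalIntegrable (by fun_prop) _ _), intervalIntegral.integral_div, integral_pow]
    simp
    left
    ring
  rw [Measure.real, gaussianReal_apply_eq_integral 0 one_ne_zero,
    ENNReal.toReal_ofReal (integral_nonneg fun x => gaussianPDFReal_nonneg 0 1 x),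
    integral_Icc_eq_integral_Ioc, ← intervalIntegral.integral_of_le hle]
  rw [h2] at h1
  refine le_trans ?_ h1
  nlinarith [mul_nonneg hm (sub_nonneg.2 hm1), mul_nonneg hm hm]

/-- The prefactor must be exactly `1`: for `d = 1` the rate has `log d = 0` and `δ` may be close to
`1`, so nothing could absorb a factor `2`. -/
lemma measureReal_gaussianReal_sq_gt_le {a : ℝ} (ha : 0 ≤ a) :
    (gaussianReal 0 1).real {x | a < x ^ 2} ≤ Real.exp (-a / 4) := by
  set γ := gaussianReal 0 1
  by_cases hsmall : Real.exp (-a / 4) ≤ 1 / 2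
  -- Large `a`: the two-sided Chernoff bound is `2 exp (-a / 2)`, and `2 exp (-a / 4) ≤ 1`.
  · set s := Real.sqrt a with hs
    have hss : s * s = a := Real.mul_self_sqrt ha
    have hmgf : ∀ t : ℝ, ∫⁻ x, ENNReal.ofReal (Real.exp (t * x)) ∂γ =
        ENNReal.ofReal (Real.exp (t * t / 2)) := fun t => by
      rw [← ofReal_integral_eq_lintegral_ofReal (integrable_exp_mul_gaussianReal t)
        (Filter.Eventually.of_forall fun x => (Real.exp_pos _).le)]
      have := congrFun (mgf_fun_id_gaussianReal (μ := 0) (v := 1)) t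
      congr 1
      simpa [mgf, sq] using this
    have hone : ∀ t : ℝ, t * t = a →
        γ.real {x | a < t * x} ≤ Real.exp (a / 2) * Real.exp (-a) := fun t ht => by
      refine measureReal_lt_le_of_lintegral_exp (measurable_const_mul t) (Real.exp_pos _).le ?_
      rw [hmgf, ht]
    have hsub : {x : ℝ | a < x ^ 2} ⊆ {x | a < s * x} ∪ {x | a < -s * x} := by
      intro x hx
      simp only [Set.mem_ofPred_eq, Set.mem_union] at hx ⊢
      have hs0 : 0 ≤ s := Real.sqrt_nonneg a
      have h1 : s < |x| := by
        rw [← Real.sqrt_sq_eq_abs]; exact Real.sqrt_lt_sqrt ha hx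
      have hspos : 0 < s := by
        refine lt_of_le_of_ne hs0 fun h => ?_
        rw [← h] at hss
        rw [← hss] at hsmall
        norm_num at hsmall
      rcases abs_cases x with ⟨h, _⟩ | ⟨h, _⟩
      · left; rw [← hss]; rw [h] at h1; exact mul_lt_mul_of_pos_left h1 hspos
      · right; rw [← hss]; rw [h] at h1
        have := mul_lt_mul_of_pos_left h1 hspos
        linarith
    have h1 := hone s hss
    have h2 := hone (-s) (by rw [neg_mul_neg, hss])
    have h3 := (measureReal_mono hsub).trans (measureReal_union_le (μ := γ) _ _)
    have h4 : Real.exp (a / 2) * Real.exp (-a) = Real.exp (-a / 4) * Real.exp (-a / 4) := by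
      rw [← Real.exp_add, ← Real.exp_add]; congr 1; ring
    rw [h4] at h1 h2
    have h5 := mul_le_mul_of_nonneg_left hsmall (Real.exp_pos (-a / 4)).le
    linarith
  -- Small `a`: use the mass near the origin. If `a ≤ 1` then `1 - 0.65 √a ≤ 1 - a / 4`; otherwise
  -- the tail is at most `0.35 < 1 / 2`.
  · rw [not_le] at hsmall
    set m := min (Real.sqrt a) 1 with hm
    have hm0 : 0 ≤ m := le_min (Real.sqrt_nonneg a) zero_le_one
    have hm1 : m ≤ 1 := min_le_right _ _
    have hI := integral_gaussianPDFReal_Icc_ge hm0 hm1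
    have hsub : {x : ℝ | a < x ^ 2} ⊆ (Set.Icc (-m) m)ᶜ := by
      intro x hx hx'
      have h1 : |x| ≤ Real.sqrt a := (abs_le.2 hx').trans (min_le_left _ _)
      have h2 : x ^ 2 ≤ a := by
        rw [← sq_abs, ← Real.sq_sqrt ha]
        exact pow_le_pow_left₀ (abs_nonneg x) h1 2
      exact not_lt.2 h2 hx
    have h1 := measureReal_mono (μ := γ) hsub
    rw [probReal_compl_eq_one_sub measurableSet_Icc] at h1
    have h2 := Real.add_one_le_exp (-a / 4)
    rcases le_total (Real.sqrt a) 1 with h | h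
    · rw [min_eq_left h] at hm
      have h3 : m * m = a := by rw [hm, Real.mul_self_sqrt ha]
      nlinarith
    · rw [min_eq_right h] at hm
      rw [hm] at hI h1
      linarith

lemma map_dotProduct_noiseLaw {n : ℕ} (u : Fin n → ℝ) (hu : sqNorm u = 1) :
    (noiseLaw n).map (fun ξ => ξ ⬝ᵥ u) = gaussianReal 0 1 := by
  set U : EuclideanSpace ℝ (Fin n) := WithLp.toLp 2 u with hU
  set L : StrongDual ℝ (EuclideanSpace ℝ (Fin n)) := InnerProductSpace.toDual ℝ _ U with hL
  have hLn : ‖L‖ ^ 2 = 1 := by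
    rw [hL, LinearIsometryEquiv.norm_map]; exact hu
  have h1 : (noiseLaw n).map (fun ξ => ξ ⬝ᵥ u) =
      (stdGaussian (EuclideanSpace ℝ (Fin n))).map L := by
    rw [← map_pi_eq_stdGaussian, Measure.map_map (by fun_prop) (by fun_prop)]
    congr 1
  rw [h1, IsGaussian.map_eq_gaussianReal, variance_dual_stdGaussian, hLn,
    integral_strongDual_stdGaussian, Real.toNNReal_one]

lemma measureReal_dotProduct_sq_gt_le {n : ℕ} (u : Fin n → ℝ) (hu : sqNorm u = 1) {a : ℝ}
    (ha : 0 ≤ a) : (noiseLaw n).real {ξ | a < (ξ ⬝ᵥ u) ^ 2} ≤ Real.exp (-a / 4) := by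
  have h := measureReal_gaussianReal_sq_gt_le ha
  rw [← map_dotProduct_noiseLaw u hu, Measure.real, Measure.map_apply (by fun_prop)
    (measurableSet_lt measurable_const (by fun_prop))] at h
  exact h

/-! ### The offset process over the column space -/

/-- In orthonormal coordinates of the column space the offset decouples, and `2 s c - c ^ 2 ≤ s ^ 2`
in each coordinate removes the dependence on `v`. -/
lemma exists_orthonormal_column_space {n d : ℕ} (X : Matrix (Fin n) (Fin d) ℝ) :
    ∃ u : Fin X.rank → Fin n → ℝ,
      (∀ h : Fin X.rank → ℝ, (∑ k, h k • u k) ⬝ᵥ (∑ k, h k • u k) = h ⬝ᵥ h) ∧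
      ∀ (ξ : Fin n → ℝ) (v : Fin d → ℝ),
        2 * (ξ ⬝ᵥ X.mulVec v) - sqNorm (X.mulVec v) ≤ ∑ k, (ξ ⬝ᵥ u k) ^ 2 := by
  set e := (WithLp.linearEquiv 2 ℝ (Fin n → ℝ)).symm
  set W : Submodule ℝ (EuclideanSpace ℝ (Fin n)) := X.mulVecLin.range.map (e : _ →ₗ[ℝ] _) with hW
  have hr : Module.finrank ℝ W = X.rank := e.finrank_map_eq _
  rw [← hr]
  set b := stdOrthonormalBasis ℝ W
  have hnorm : ∀ h : Fin (Module.finrank ℝ W) → ℝ,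
      (∑ k, h k • (b k : EuclideanSpace ℝ (Fin n)).ofLp) ⬝ᵥ
        (∑ k, h k • (b k : EuclideanSpace ℝ (Fin n)).ofLp) = h ⬝ᵥ h := fun h => by
    have h1 : (∑ k, h k • (b k : EuclideanSpace ℝ (Fin n)).ofLp) =
        ((b.repr.symm (WithLp.toLp 2 h) : W) : EuclideanSpace ℝ (Fin n)).ofLp := by
      rw [← b.sum_repr_symm]
      simp
    rw [h1, ← sqNorm_eq_dotProduct, ← sqNorm_eq_dotProduct, sqNorm, sqNorm, WithLp.toLp_ofLp,
      Submodule.norm_coe, LinearIsometryEquiv.norm_map]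
  refine ⟨fun k => (b k : EuclideanSpace ℝ (Fin n)).ofLp, hnorm, fun ξ v => ?_⟩
  have hv : WithLp.toLp 2 (X.mulVec v) ∈ W := ⟨X.mulVec v, ⟨v, rfl⟩, rfl⟩
  set c := (b.repr ⟨_, hv⟩).ofLp with hc
  have h1 : X.mulVec v = ∑ k, c k • (b k : EuclideanSpace ℝ (Fin n)).ofLp := by
    have := congrArg (fun w : W => (w : EuclideanSpace ℝ (Fin n)).ofLp) (b.sum_repr ⟨_, hv⟩)
    simp only [Submodule.coe_sum, Submodule.coe_smul, WithLp.ofLp_sum, WithLp.ofLp_smul] at this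
    exact this.symm
  rw [h1, sqNorm_eq_dotProduct, hnorm, dotProduct_sum, dotProduct, Finset.mul_sum,
    ← Finset.sum_sub_distrib]
  refine Finset.sum_le_sum fun k _ => ?_
  rw [dotProduct_smul, smul_eq_mul]
  nlinarith [sq_nonneg (ξ ⬝ᵥ (b k : EuclideanSpace ℝ (Fin n)).ofLp - c k)]

/-- Chernoff for a chi-square variable with `X.rank` degrees of freedom; the term `2 * X.rank` in
the threshold outweighs the moment `√2 ^ X.rank`. -/
lemma offset_rank_bound {n d : ℕ} (X : Matrix (Fin n) (Fin d) ℝ) {δ : ℝ} (hδ : 0 < δ) :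
    ∃ B : Set (Fin n → ℝ), MeasurableSet B ∧ (noiseLaw n).real B ≤ δ ∧
      ∀ ξ ∉ B, ∀ v : Fin d → ℝ, 2 * (ξ ⬝ᵥ X.mulVec v) - sqNorm (X.mulVec v) ≤
        8 * X.rank + 4 * Real.log (1 / δ) := by
  obtain ⟨u, hu, hoff⟩ := exists_orthonormal_column_space X
  have hmeas : Measurable fun ξ : Fin n → ℝ => (∑ k, (ξ ⬝ᵥ u k) ^ 2) / 4 := by fun_prop
  refine ⟨{ξ | 2 * X.rank + Real.log (1 / δ) < (∑ k, (ξ ⬝ᵥ u k) ^ 2) / 4},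
    measurableSet_lt measurable_const hmeas, ?_, fun ξ hξ v => ?_⟩
  · refine (measureReal_lt_le_of_lintegral_exp hmeas (by positivity)
      (lintegral_exp_sum_sq_le u fun h => (hu h).le)).trans ?_
    have h1 : Real.sqrt 2 ≤ Real.exp 2 := by
      have := Real.add_one_le_exp (2 : ℝ)
      have : Real.sqrt 2 ≤ 2 := Real.sqrt_le_iff.2 ⟨by norm_num, by norm_num⟩
      linarith
    calc Real.sqrt 2 ^ X.rank * Real.exp (-(2 * X.rank + Real.log (1 / δ)))
        ≤ Real.exp 2 ^ X.rank * Real.exp (-(2 * X.rank + Real.log (1 / δ))) := by gcongr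
      _ = Real.exp (Real.log δ) := by
          rw [← Real.exp_nat_mul, ← Real.exp_add, one_div, Real.log_inv]; congr 1; ring
      _ = δ := Real.exp_log hδ
  · have h1 := hoff ξ v
    have h2 : (∑ k, (ξ ⬝ᵥ u k) ^ 2) / 4 ≤ 2 * X.rank + Real.log (1 / δ) := not_lt.1 hξ
    linarith

/-- The rank is at most one, so the scalar tail with prefactor `1` avoids any additive constant. -/
lemma offset_one_bound {n : ℕ} (X : Matrix (Fin n) (Fin 1) ℝ) {δ : ℝ} (hδ : 0 < δ)
    (hδ1 : δ ≤ 1) :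
    ∃ B : Set (Fin n → ℝ), MeasurableSet B ∧ (noiseLaw n).real B ≤ δ ∧
      ∀ ξ ∉ B, ∀ v : Fin 1 → ℝ, 2 * (ξ ⬝ᵥ X.mulVec v) - sqNorm (X.mulVec v) ≤
        4 * Real.log (1 / δ) := by
  obtain ⟨u, hu, hoff⟩ := exists_orthonormal_column_space X
  have hlog : 0 ≤ Real.log (1 / δ) := Real.log_nonneg (by rw [le_div_iff₀ hδ]; linarith)
  have hr := X.rank_le_width
  generalize X.rank = r at u hu hoff hr
  interval_cases r
  · refine ⟨∅, MeasurableSet.empty, by simpa using hδ.le, fun ξ _ v => (hoff ξ v).trans ?_⟩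
    rw [Finset.univ_eq_empty, Finset.sum_empty]
    positivity
  · have hu1 : sqNorm (u 0) = 1 := by
      have := hu fun _ => 1
      rw [sqNorm_eq_dotProduct]
      simpa [dotProduct] using this
    refine ⟨{ξ | 4 * Real.log (1 / δ) < (ξ ⬝ᵥ u 0) ^ 2},
      measurableSet_lt measurable_const (by fun_prop), ?_, fun ξ hξ v => (hoff ξ v).trans ?_⟩
    · refine (measureReal_dotProduct_sq_gt_le (u 0) hu1 (by positivity)).trans_eq ?_
      rw [show -(4 * Real.log (1 / δ)) / 4 = Real.log δ by
        rw [one_div, Real.log_inv]; ring, Real.exp_log hδ]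
    · rw [Fin.sum_univ_one]
      exact not_lt.1 hξ

/-! ### The offset process over a polytope -/

/-- Each `exp (⟨ξ, w⟩ - ‖w‖² / 2)` has mean exactly `1`, so Markov for the sum costs only the
logarithm of the cardinality, whatever the lengths of the `w c`. -/
lemma offset_finite_bound {n : ℕ} {κ : Type*} [Fintype κ] [Nonempty κ] (w : κ → Fin n → ℝ)
    {δ : ℝ} (hδ : 0 < δ) :
    ∃ B : Set (Fin n → ℝ), MeasurableSet B ∧ (noiseLaw n).real B ≤ δ ∧
      ∀ ξ ∉ B, ∀ c, 2 * (ξ ⬝ᵥ w c) - sqNorm (w c) ≤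
        2 * Real.log (Fintype.card κ) + 2 * Real.log (1 / δ) := by
  have hcard : (0 : ℝ) < Fintype.card κ := by exact_mod_cast Fintype.card_pos
  have hmeas : Measurable fun ξ : Fin n → ℝ => ∑ c, Real.exp (ξ ⬝ᵥ w c - sqNorm (w c) / 2) := by
    fun_prop
  have hone : ∀ c, ∫⁻ ξ, ENNReal.ofReal (Real.exp (ξ ⬝ᵥ w c - sqNorm (w c) / 2)) ∂(noiseLaw n) =
      1 := fun c => by
    simp only [sub_eq_add_neg, Real.exp_add, ENNReal.ofReal_mul (Real.exp_pos _).le]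
    rw [lintegral_mul_const _ (by fun_prop), lintegral_exp_dotProduct,
      ← ENNReal.ofReal_mul (Real.exp_pos _).le, ← Real.exp_add, sqNorm_eq_dotProduct]
    simp
  refine ⟨{ξ | Fintype.card κ / δ < ∑ c, Real.exp (ξ ⬝ᵥ w c - sqNorm (w c) / 2)},
    measurableSet_lt measurable_const hmeas, ?_, fun ξ hξ c => ?_⟩
  · refine (measureReal_lt_le_of_lintegral hmeas hcard.le (by positivity) ?_).trans_eq
      (by field_simp)
    simp only [ENNReal.ofReal_sum_of_nonneg fun c _ => (Real.exp_pos _).le]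
    rw [lintegral_finsetSum _ fun c _ => by fun_prop]
    simp [hone]
  · have h1 : Real.exp (ξ ⬝ᵥ w c - sqNorm (w c) / 2) ≤ Fintype.card κ / δ :=
      (Finset.single_le_sum (f := fun c => Real.exp (ξ ⬝ᵥ w c - sqNorm (w c) / 2))
        (fun c _ => (Real.exp_pos _).le) (Finset.mem_univ c)).trans (not_lt.1 hξ)
    rw [← Real.le_log_iff_exp_le (by positivity), div_eq_mul_one_div (_ : ℝ) δ,
      Real.log_mul hcard.ne' (by positivity)] at h1
    linarith

/-- Greedy sparsification of a point `v` of a polytope with vertices `w i`. -/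
lemma exists_greedy_vertices {n : ℕ} {κ : Type*} (w : κ → Fin n → ℝ) {M : ℝ}
    (hM : ∀ i, sqNorm (w i) ≤ M) {v : Fin n → ℝ} (hv : ∀ g : Fin n → ℝ, ∃ i, g ⬝ᵥ v ≤ g ⬝ᵥ w i)
    (a : Fin n → ℝ) (m : ℕ) :
    ∃ c : Fin m → κ, -(m * M) ≤ a ⬝ᵥ (∑ i, w (c i) - (m : ℝ) • v) -
      sqNorm (∑ i, w (c i) - (m : ℝ) • v) := by
  induction m with
  | zero => exact ⟨Fin.elim0, by simp [sqNorm]⟩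
  | succ m ih =>
    obtain ⟨c, hc⟩ := ih
    generalize hh : ∑ i, w (c i) - (m : ℝ) • v = h at hc
    -- Adding `w i - v` to `h` changes the functional by `⟨a - 2h + 2v, w i - v⟩ + ‖v‖² - ‖w i‖²`. A
    -- vertex making the pairing nonnegative loses at most `M`.
    obtain ⟨i, hi⟩ := hv (a - (2 : ℝ) • h + (2 : ℝ) • v)
    refine ⟨Fin.snoc c i, ?_⟩
    have e : ∑ j, w ((Fin.snoc c i : Fin (m + 1) → κ) j) - ((m + 1 : ℕ) : ℝ) • v =
        h + (w i - v) := by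
      rw [Fin.sum_univ_castSucc]
      simp only [Fin.snoc_castSucc, Fin.snoc_last]
      push_cast
      rw [add_smul, one_smul, ← hh]
      abel
    rw [e, dotProduct_add, sqNorm_add, sqNorm_sub]
    have h1 := hM i
    have h2 := sqNorm_nonneg v
    simp only [add_dotProduct, sub_dotProduct, smul_dotProduct, smul_eq_mul] at hi
    rw [dotProduct_sub a, dotProduct_sub h, dotProduct_comm (w i) v]
    push_cast
    rw [← sqNorm_eq_dotProduct] at hi
    linarith

/-- A derandomized Maurey argument: averages of `k` vertices, a finite family when `κ` is finite,
replace `v` at cost `M / k`. -/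
lemma exists_average_vertices {n : ℕ} {κ : Type*} (w : κ → Fin n → ℝ) {M : ℝ}
    (hM : ∀ i, sqNorm (w i) ≤ M) {v : Fin n → ℝ} (hv : ∀ g : Fin n → ℝ, ∃ i, g ⬝ᵥ v ≤ g ⬝ᵥ w i)
    (ξ : Fin n → ℝ) {k : ℕ} (hk : 0 < k) :
    ∃ c : Fin k → κ, 2 * (ξ ⬝ᵥ v) - sqNorm v ≤
      2 * (ξ ⬝ᵥ ((k : ℝ)⁻¹ • ∑ i, w (c i))) - sqNorm ((k : ℝ)⁻¹ • ∑ i, w (c i)) + M / k := by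
  have hk0 : (0 : ℝ) < k := by exact_mod_cast hk
  -- With this linear part, the greedy functional divided by `k ^ 2` is the increment of `2⟨ξ, ·⟩ -
  -- ‖·‖²` from `v` to the average.
  obtain ⟨c, hc⟩ := exists_greedy_vertices w hM hv ((2 * (k : ℝ)) • (ξ - v)) k
  refine ⟨c, ?_⟩
  set h := ∑ i, w (c i) - (k : ℝ) • v with hh
  have e : (k : ℝ)⁻¹ • ∑ i, w (c i) = v + (k : ℝ)⁻¹ • h := by
    rw [hh, smul_sub, smul_smul, inv_mul_cancel₀ hk0.ne', one_smul]; abel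
  rw [e, dotProduct_add, sqNorm_add, sqNorm_smul, dotProduct_smul, dotProduct_smul]
  simp only [smul_dotProduct, sub_dotProduct, smul_eq_mul] at hc ⊢
  have h2 : -(M / k) ≤ 2 * ((k : ℝ)⁻¹ * (ξ ⬝ᵥ h)) - 2 * ((k : ℝ)⁻¹ * (v ⬝ᵥ h)) -
      (k : ℝ)⁻¹ ^ 2 * sqNorm h := by
    have h3 := mul_le_mul_of_nonneg_left hc (sq_nonneg (k : ℝ)⁻¹)
    have e1 : (k : ℝ)⁻¹ ^ 2 * -(k * M) = -(M / k) := by field_simp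
    have e2 : (k : ℝ)⁻¹ ^ 2 * (2 * k * (ξ ⬝ᵥ h - v ⬝ᵥ h) - sqNorm h) =
        2 * ((k : ℝ)⁻¹ * (ξ ⬝ᵥ h)) - 2 * ((k : ℝ)⁻¹ * (v ⬝ᵥ h)) - (k : ℝ)⁻¹ ^ 2 * sqNorm h := by
      field_simp
    rw [e1, e2] at h3
    exact h3
  linarith

lemma dotProduct_mulVec_le_mul_sum_abs {n d : ℕ} (X : Matrix (Fin n) (Fin d) ℝ) (g : Fin n → ℝ)
    (v : Fin d → ℝ) {A : ℝ} (hA : ∀ j, |g ⬝ᵥ fun i => X i j| ≤ A) :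
    g ⬝ᵥ X.mulVec v ≤ A * ∑ j, |v j| := by
  rw [Matrix.dotProduct_mulVec, Finset.mul_sum]
  refine Finset.sum_le_sum fun j _ => ?_
  calc Matrix.vecMul g X j * v j ≤ |Matrix.vecMul g X j * v j| := le_abs_self _
    _ = |g ⬝ᵥ fun i => X i j| * |v j| := abs_mul _ _
    _ ≤ _ := mul_le_mul_of_nonneg_right (hA j) (abs_nonneg _)

/-- The signed and rescaled columns of a design. -/
def signedColumn {n d : ℕ} (X : Matrix (Fin n) (Fin d) ℝ) (R : ℝ) (i : Fin d × Bool) :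
    Fin n → ℝ :=
  (if i.2 then R else -R) • fun k => X k i.1

lemma sqNorm_signedColumn_le {n d : ℕ} {X : Matrix (Fin n) (Fin d) ℝ} (hX : ColumnNormalized X)
    (R : ℝ) (i : Fin d × Bool) : sqNorm (signedColumn X R i) ≤ R ^ 2 * n := by
  have h1 : sqNorm (fun k => X k i.1) ≤ n := by
    have h := pow_le_pow_left₀ (norm_nonneg _) (hX i.1) 2
    rwa [Real.sq_sqrt (Nat.cast_nonneg n)] at h
  have h2 : (if i.2 then R else -R) ^ 2 = R ^ 2 := by split_ifs <;> ring
  rw [signedColumn, sqNorm_smul, h2]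
  exact mul_le_mul_of_nonneg_left h1 (sq_nonneg R)

/-- Support-function form of membership of `X v` in the convex hull of the signed columns, as the
sparsification requires. -/
lemma exists_signedColumn_ge {n d : ℕ} (hd : 1 ≤ d) (X : Matrix (Fin n) (Fin d) ℝ) {R : ℝ}
    {v : Fin d → ℝ} (hv : ∑ j, |v j| ≤ R) (g : Fin n → ℝ) :
    ∃ i, g ⬝ᵥ X.mulVec v ≤ g ⬝ᵥ signedColumn X R i := by
  have : Nonempty (Fin d) := ⟨⟨0, hd⟩⟩
  obtain ⟨j, hj⟩ := Finite.exists_max fun j => |g ⬝ᵥ fun i => X i j|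
  have h1 := (dotProduct_mulVec_le_mul_sum_abs X g v hj).trans
    (mul_le_mul_of_nonneg_left hv (abs_nonneg _))
  rcases abs_cases (g ⬝ᵥ fun i => X i j) with ⟨h, _⟩ | ⟨h, _⟩
  · refine ⟨(j, true), h1.trans_eq ?_⟩
    rw [h, signedColumn, dotProduct_smul]
    simp [mul_comm]
  · refine ⟨(j, false), h1.trans_eq ?_⟩
    rw [h, signedColumn, dotProduct_smul]
    simp [mul_comm]

lemma offset_sum_abs_bound {n d : ℕ} (hn : 1 ≤ n) (hd : 1 ≤ d) {X : Matrix (Fin n) (Fin d) ℝ}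
    (hX : ColumnNormalized X) {R δ : ℝ} (hR : 0 < R) (hδ : 0 < δ) (hδ1 : δ ≤ 1) :
    ∃ B : Set (Fin n → ℝ), MeasurableSet B ∧ (noiseLaw n).real B ≤ δ ∧
      ∀ ξ ∉ B, ∀ v : Fin d → ℝ, ∑ j, |v j| ≤ R →
        2 * (ξ ⬝ᵥ X.mulVec v) - sqNorm (X.mulVec v) ≤
          3 * (R * Real.sqrt n * Real.sqrt (2 * Real.log (2 * d))) + 2 * Real.log (1 / δ) := by
  have hn0 : (0 : ℝ) < n := by exact_mod_cast hn
  have hd1 : (1 : ℝ) ≤ d := by exact_mod_cast hd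
  have : Nonempty (Fin d) := ⟨⟨0, hd⟩⟩
  set L := Real.log (2 * d) with hL
  have hLpos : 0 < L := Real.log_pos (by linarith)
  have hlog : 0 ≤ Real.log (1 / δ) := Real.log_nonneg (by rw [le_div_iff₀ hδ]; linarith)
  set σ := Real.sqrt (2 * L) with hσ
  have hσ0 : 0 < σ := Real.sqrt_pos.2 (by linarith)
  have hσ2 : σ * σ = 2 * L := Real.mul_self_sqrt (by linarith)
  set N := Real.sqrt n with hN
  have hN0 : 0 < N := Real.sqrt_pos.2 hn0
  have hN2 : N * N = n := Real.mul_self_sqrt hn0.le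
  have hcard : Fintype.card (Fin d × Bool) = 2 * d := by simp [mul_comm]
  rcases le_or_gt (R * N) σ with hx | hx
  -- Small radius: apply the finite bound to columns scaled to length at most `σ`, where `‖w‖²` and
  -- `2 log (2 d)` balance, and shrink the resulting linear bound by `R N / σ ≤ 1`.
  · obtain ⟨B, hBm, hB, hoff⟩ := offset_finite_bound (signedColumn X (σ / N)) hδ
    refine ⟨B, hBm, hB, fun ξ hξ v hv => ?_⟩
    have hbound : ∀ i, 2 * (ξ ⬝ᵥ signedColumn X R i) ≤
        2 * (R * N * σ) + 2 * Real.log (1 / δ) := fun i => by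
      have h1 := hoff ξ hξ i
      have h2 := sqNorm_signedColumn_le hX (σ / N) i
      have e1 : (σ / N) ^ 2 * n = σ * σ := by rw [← hN2]; field_simp
      rw [hcard] at h1
      push_cast at h1
      rw [← hL] at h1
      have e2 : signedColumn X R i = (R * N / σ) • signedColumn X (σ / N) i := by
        simp only [signedColumn, smul_smul]
        congr 1
        split_ifs <;> field_simp
      have h3 : 2 * (ξ ⬝ᵥ signedColumn X (σ / N) i) ≤
          2 * (σ * σ) + 2 * Real.log (1 / δ) := by linarith
      have hr1 : R * N / σ ≤ 1 := (div_le_one hσ0).2 hx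
      have hr0 : 0 ≤ R * N / σ := by positivity
      have h4 := mul_le_mul_of_nonneg_left h3 hr0
      have h5 : R * N / σ * (2 * Real.log (1 / δ)) ≤ 2 * Real.log (1 / δ) :=
        mul_le_of_le_one_left (by positivity) hr1
      have e3 : R * N / σ * (2 * (σ * σ)) = 2 * (R * N * σ) := by field_simp
      rw [e2, dotProduct_smul, smul_eq_mul]
      linarith
    obtain ⟨i, hi⟩ := exists_signedColumn_ge hd X hv ξ
    have h1 := hbound i
    have h2 := sqNorm_nonneg (X.mulVec v)
    have h3 : 0 ≤ R * N * σ := by positivity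
    linarith
  · set x := R * N / σ with hxdef
    have hx1 : 1 ≤ x := (one_le_div hσ0).2 hx.le
    -- This `k` balances the sparsification error `R ^ 2 n / k ≤ R N σ` with the union bound `2 k
    -- L`, at most `2 R N σ` because `k ≤ 2 x`.
    set k := ⌈x⌉₊ with hk
    have hkx : x ≤ k := Nat.le_ceil x
    have hkx2 : (k : ℝ) < x + 1 := Nat.ceil_lt_add_one (by linarith)
    have hk0 : 0 < k := Nat.ceil_pos.2 (by linarith)
    obtain ⟨B, hBm, hB, hoff⟩ := offset_finite_bound (κ := Fin k → Fin d × Bool)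
      (fun c => (k : ℝ)⁻¹ • ∑ i, signedColumn X R (c i)) hδ
    refine ⟨B, hBm, hB, fun ξ hξ v hv => ?_⟩
    obtain ⟨c, hc⟩ := exists_average_vertices (signedColumn X R) (sqNorm_signedColumn_le hX R)
      (exists_signedColumn_ge hd X hv) ξ hk0
    have h1 := hoff ξ hξ c
    rw [Fintype.card_fun, hcard, Fintype.card_fin] at h1
    push_cast at h1
    rw [Real.log_pow, ← hL] at h1
    have h2 : R ^ 2 * n / k ≤ R * N * σ := by
      calc R ^ 2 * n / k ≤ R ^ 2 * n / x := by gcongr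
        _ = R * N * σ := by rw [hxdef, ← hN2]; field_simp
    have h3 : 2 * (k * L) ≤ 2 * (R * N * σ) := by
      have : k * L ≤ 2 * x * L := mul_le_mul_of_nonneg_right (by linarith) hLpos.le
      have e : 2 * x * L = R * N * σ := by
        rw [hxdef, show L = σ * σ / 2 by linarith]; field_simp
      linarith
    linarith

/-! ### The column-normalized design -/

lemma sum_abs_le_rpow_mul_lpNorm {p q : ℝ} (hp : 1 < p) (hpq : 1 / p + 1 / q = 1) {d : ℕ}
    (α : Param d) : ∑ j, |α j| ≤ (d : ℝ) ^ (1 / q) * lpNorm p α := by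
  have hc : p.HolderConjugate q := Real.holderConjugate_iff.2 ⟨hp, by simpa using hpq⟩
  have h := Real.inner_le_Lp_mul_Lq_of_nonneg Finset.univ (f := fun j => |α j|) (g := fun _ => 1)
    hc (fun _ _ => abs_nonneg _) (fun _ _ => zero_le_one)
  simp only [mul_one, Real.one_rpow, Finset.sum_const, Finset.card_univ, Fintype.card_fin,
    nsmul_eq_mul] at h
  rw [mul_comm]
  exact h

lemma offset_column_bound {p q τ δ : ℝ} (hp : 1 < p) (hpq : 1 / p + 1 / q = 1) {n d : ℕ}
    (hn : 1 ≤ n) (hd : 1 ≤ d) (hτ : 0 < τ) (hδ : 0 < δ) (hδ1 : δ < 1)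
    {X : Matrix (Fin n) (Fin d) ℝ} (hX : ColumnNormalized X) :
    ∃ B : Set (Fin n → ℝ), MeasurableSet B ∧ (noiseLaw n).real B ≤ δ ∧
      ∀ ξ ∉ B, ∀ Δ : Param d, lpNorm p Δ ≤ (2 + Real.sqrt 2) * τ →
        2 * (ξ ⬝ᵥ X.mulVec Δ.ofLp) - sqNorm (X.mulVec Δ.ofLp) ≤
          n * (columnBound q τ δ X / 2) := by
  have hn0 : (0 : ℝ) < n := by exact_mod_cast hn
  unfold columnBound
  rcases le_total (16 * (X.rank : ℝ) / n)
    (48 * τ * Real.sqrt (Real.log d / n) * (d : ℝ) ^ (1 / q)) with h | h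
  · obtain ⟨B, hBm, hB, hoff⟩ := offset_rank_bound X hδ
    refine ⟨B, hBm, hB, fun ξ hξ Δ _ => (hoff ξ hξ Δ.ofLp).trans_eq ?_⟩
    rw [min_eq_left h]
    field_simp
    ring
  rw [min_eq_right h]
  have e : n * ((48 * τ * Real.sqrt (Real.log d / n) * (d : ℝ) ^ (1 / q) +
      8 * Real.log (1 / δ) / n) / 2) =
      24 * (τ * Real.sqrt n * Real.sqrt (Real.log d) * (d : ℝ) ^ (1 / q)) +
        4 * Real.log (1 / δ) := by
    have hs : (n : ℝ) * Real.sqrt (Real.log d / n) = Real.sqrt n * Real.sqrt (Real.log d) := by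
      rw [Real.sqrt_div' _ hn0.le]
      have := Real.mul_self_sqrt hn0.le
      have h0 : 0 < Real.sqrt n := Real.sqrt_pos.2 hn0
      field_simp
      rw [sq, this, mul_comm]
    have h8 : (n : ℝ) * (8 * Real.log (1 / δ) / n) = 8 * Real.log (1 / δ) := by field_simp
    linear_combination (24 * τ * (d : ℝ) ^ (1 / q)) * hs + h8 / 2
  rw [e]
  rcases hd.eq_or_lt with rfl | hd2
  -- For `d = 1` the term with `√(log d)` vanishes, and only `4 log (1 / δ)` is available.
  · obtain ⟨B, hBm, hB, hoff⟩ := offset_one_bound X hδ hδ1.le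
    refine ⟨B, hBm, hB, fun ξ hξ Δ _ => (hoff ξ hξ Δ.ofLp).trans_eq ?_⟩
    simp
  · have hd2' : (2 : ℝ) ≤ d := by exact_mod_cast hd2
    have hD : (0 : ℝ) < (d : ℝ) ^ (1 / q) := Real.rpow_pos_of_pos (by linarith) _
    obtain ⟨B, hBm, hB, hoff⟩ := offset_sum_abs_bound hn hd hX
      (R := (d : ℝ) ^ (1 / q) * ((2 + Real.sqrt 2) * τ)) (by positivity) hδ hδ1.le
    refine ⟨B, hBm, hB, fun ξ hξ Δ hΔ => ?_⟩
    have h1 := hoff ξ hξ Δ.ofLp ((sum_abs_le_rpow_mul_lpNorm hp hpq Δ).trans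
      (mul_le_mul_of_nonneg_left hΔ hD.le))
    refine h1.trans ?_
    have hl2 : 0 ≤ Real.log 2 := Real.log_nonneg (by norm_num)
    have hld : Real.log 2 ≤ Real.log d := Real.log_le_log two_pos hd2'
    -- Here `d ≥ 2` enters. With `2 + √2 ≤ 4` the constant becomes `3 · 4 · 2 = 24`, half of `48`.
    have hs1 : Real.sqrt (2 * Real.log (2 * d)) ≤ 2 * Real.sqrt (Real.log d) := by
      rw [Real.sqrt_le_left (by positivity), mul_pow, Real.sq_sqrt (by linarith),
        Real.log_mul two_ne_zero (by linarith)]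
      linarith
    have hs2 : Real.sqrt 2 ≤ 2 := Real.sqrt_le_iff.2 ⟨by norm_num, by norm_num⟩
    have hlog : 0 ≤ Real.log (1 / δ) := Real.log_nonneg (by rw [le_div_iff₀ hδ]; linarith)
    have h2 : (d : ℝ) ^ (1 / q) * ((2 + Real.sqrt 2) * τ) * Real.sqrt n *
        Real.sqrt (2 * Real.log (2 * d)) ≤
        (d : ℝ) ^ (1 / q) * ((2 + 2) * τ) * Real.sqrt n * (2 * Real.sqrt (Real.log d)) := by
      gcongr
    have h3 : (d : ℝ) ^ (1 / q) * ((2 + 2) * τ) * Real.sqrt n * (2 * Real.sqrt (Real.log d)) =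
        8 * (τ * Real.sqrt n * Real.sqrt (Real.log d) * (d : ℝ) ^ (1 / q)) := by ring
    linarith

/-- Needed for `ε > 0`; the logarithm supplies it even when the minimum is zero. -/
lemma columnBound_pos {q τ δ : ℝ} {n d : ℕ} (hn : 1 ≤ n) (hτ : 0 < τ) (hδ : 0 < δ) (hδ1 : δ < 1)
    (X : Matrix (Fin n) (Fin d) ℝ) : 0 < columnBound q τ δ X := by
  have hn0 : (0 : ℝ) < n := by exact_mod_cast hn
  have hlog : 0 < Real.log (1 / δ) := Real.log_pos (by rw [lt_div_iff₀ hδ]; linarith)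
  have : (0 : ℝ) ≤ (d : ℝ) ^ (1 / q) := Real.rpow_nonneg (Nat.cast_nonneg d) _
  exact add_pos_of_nonneg_of_pos (le_min (by positivity) (by positivity)) (by positivity)

theorem withProbAtLeast_columnBound {p q τ δ : ℝ} (hp : 1 < p) (hp2 : p < 2)
    (hpq : 1 / p + 1 / q = 1) {n d : ℕ} (hn : 1 ≤ n) (hd : 1 ≤ d) (hτ : 0 < τ) (hδ : 0 < δ)
    (hδ1 : δ < 1) {X : Matrix (Fin n) (Fin d) ℝ} (hX : ColumnNormalized X) :
    WithProbAtLeast (noiseLaw n) (1 - Real.exp (-0.1 * n) - δ)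
      {ξ | LpESMDRiskLE p τ (columnBound q τ δ X / 2) (columnBound q τ δ X) X ξ} := by
  obtain ⟨B, hBm, hB, hoff⟩ := offset_column_bound hp hpq hn hd hτ hδ hδ1 hX
  refine withProbAtLeast_of_bad_sets (measurableSet_lt measurable_const measurable_sqNorm) hBm
    (measureReal_two_mul_lt_sqNorm_le n) hB le_rfl fun ξ hξ hξB => ?_
  have hpos := columnBound_pos (q := q) hn hτ hδ hδ1 X
  have h := lpESMDRiskLE_of_offset hp hp2 hn hd hτ (half_pos hpos) (half_pos hpos).le
    (not_lt.1 hξ) (hoff ξ hξB)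
  rw [add_halves] at h
  exact h

/-! ### The Gaussian design -/

/-- The roles are exchanged: `ξ` is fixed and the column is the Gaussian vector, so the case `r = 1`
of `lintegral_exp_sum_sq_le` applies to `ξ / √(2n)`. -/
lemma lintegral_design_exp_le {n d : ℕ} (hn : 1 ≤ n) {ξ : Fin n → ℝ} (hξ : sqNorm ξ ≤ 2 * n)
    (j : Fin d) :
    ∫⁻ X, ENNReal.ofReal (Real.exp ((ξ ⬝ᵥ fun i => X i j) ^ 2 / (8 * n))) ∂(designLaw n d) ≤
      ENNReal.ofReal (Real.sqrt 2) := by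
  have hn0 : (0 : ℝ) < n := by exact_mod_cast hn
  have hmp : MeasurePreserving (fun (X : Fin n → Fin d → ℝ) i => X i j) (designLaw n d)
      (noiseLaw n) :=
    measurePreserving_pi _ _ fun _ => measurePreserving_eval (fun _ => gaussianReal 0 1) j
  set s := (Real.sqrt (2 * n))⁻¹ with hs
  have hs2 : s ^ 2 = 1 / (2 * n) := by
    rw [hs, inv_pow, Real.sq_sqrt (by positivity), one_div]
  have h := lintegral_exp_sum_sq_le (n := n) (r := 1) (fun _ => s • ξ) fun h => by
    rw [Fin.sum_univ_one, smul_smul, ← sqNorm_eq_dotProduct, sqNorm_smul, mul_pow, hs2]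
    have e : h ⬝ᵥ h = h 0 ^ 2 * 1 := by simp [dotProduct, sq]
    rw [e, mul_assoc]
    refine mul_le_mul_of_nonneg_left ?_ (sq_nonneg _)
    rw [one_div, inv_mul_le_iff₀ (by positivity)]
    linarith
  rw [pow_one] at h
  refine le_trans (le_of_eq ?_) h
  have e : ∀ x : Fin n → ℝ, (∑ _k : Fin 1, (x ⬝ᵥ s • ξ) ^ 2) / 4 = (x ⬝ᵥ ξ) ^ 2 / (8 * n) :=
    fun x => by
      rw [Fin.sum_univ_one, dotProduct_smul, smul_eq_mul, mul_pow, hs2]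
      field_simp
      ring
  simp only [e]
  rw [← hmp.lintegral_comp (by fun_prop)]
  simp only [dotProduct_comm ξ]

/-- The sum of the Gaussian exponentials of the entries of `Xᵀ ξ / √n`. -/
noncomputable def correlationExpSum {n d : ℕ} (X : Fin n → Fin d → ℝ) (ξ : Fin n → ℝ) : ℝ :=
  ∑ j, Real.exp ((ξ ⬝ᵥ fun i => X i j) ^ 2 / (8 * n))

lemma measurable_correlationExpSum {n d : ℕ} :
    Measurable fun ω : (Fin n → Fin d → ℝ) × (Fin n → ℝ) => correlationExpSum ω.1 ω.2 := by
  unfold correlationExpSum dotProduct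
  fun_prop

lemma lintegral_correlationExpSum_le {n d : ℕ} (hn : 1 ≤ n) {ξ : Fin n → ℝ}
    (hξ : sqNorm ξ ≤ 2 * n) :
    ∫⁻ X, ENNReal.ofReal (correlationExpSum X ξ) ∂(designLaw n d) ≤
      ENNReal.ofReal (d * Real.sqrt 2) := by
  simp only [correlationExpSum, ENNReal.ofReal_sum_of_nonneg fun j _ => (Real.exp_pos _).le]
  rw [lintegral_finsetSum _ fun c _ => by unfold dotProduct; fun_prop]
  refine (Finset.sum_le_sum fun j _ => lintegral_design_exp_le hn hξ j).trans_eq ?_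
  rw [Finset.sum_const, Finset.card_univ, Fintype.card_fin, nsmul_eq_mul,
    ENNReal.ofReal_mul (Nat.cast_nonneg d), ENNReal.ofReal_natCast]

/-- Setting the sum to zero for large noise makes the conditional moment bound valid for every `ξ`;
Fubini and Markov then give `√2 / 150 ≤ 0.01`. The event involves neither `p` nor `τ` and serves
both regimes of the rate. -/
lemma exists_design_bad_set {n : ℕ} (hn : 1 ≤ n) {d : ℕ} (hd : 1 ≤ d) :
    ∃ B : Set ((Fin n → Fin d → ℝ) × (Fin n → ℝ)), MeasurableSet B ∧
      ((designLaw n d).prod (noiseLaw n)).real B ≤ 0.01 ∧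
      ∀ ω ∉ B, sqNorm ω.2 ≤ 2 * n → correlationExpSum ω.1 ω.2 ≤ 150 * d := by
  classical
  have hd0 : (0 : ℝ) < d := by exact_mod_cast hd
  have hfm : Measurable fun ω : (Fin n → Fin d → ℝ) × (Fin n → ℝ) =>
      if sqNorm ω.2 ≤ 2 * n then correlationExpSum ω.1 ω.2 else 0 :=
    Measurable.ite (measurableSet_le (measurable_sqNorm.comp measurable_snd) measurable_const)
      measurable_correlationExpSum measurable_const
  refine ⟨{ω | 150 * (d : ℝ) < if sqNorm ω.2 ≤ 2 * n then correlationExpSum ω.1 ω.2 else 0},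
    measurableSet_lt measurable_const hfm, ?_, fun ω hω hξ => ?_⟩
  · refine (measureReal_lt_le_of_lintegral (A := d * Real.sqrt 2) hfm (by positivity)
      (by positivity) ?_).trans ?_
    · rw [lintegral_prod_symm _ hfm.ennreal_ofReal.aemeasurable]
      have hb : ∀ ξ : Fin n → ℝ, ∫⁻ X, ENNReal.ofReal
          (if sqNorm ξ ≤ 2 * n then correlationExpSum X ξ else 0) ∂(designLaw n d) ≤
          ENNReal.ofReal (d * Real.sqrt 2) := fun ξ => by
        by_cases hξ : sqNorm ξ ≤ 2 * n
        · simp only [if_pos hξ]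
          exact lintegral_correlationExpSum_le hn hξ
        · simp [if_neg hξ]
      refine (lintegral_mono hb).trans_eq ?_
      simp
    · rw [div_le_iff₀ (by positivity)]
      have : Real.sqrt 2 ≤ 1.5 := Real.sqrt_le_iff.2 ⟨by norm_num, by norm_num⟩
      nlinarith
  · have h1 : (if sqNorm ω.2 ≤ 2 * n then correlationExpSum ω.1 ω.2 else 0) ≤ 150 * d :=
      not_lt.1 hω
    rwa [if_pos hξ] at h1

/-! ### From the exponential sum to the rate -/

lemma dotProduct_mulVec_le_lq {p q : ℝ} (hp : 1 < p) (hpq : 1 / p + 1 / q = 1) {n d : ℕ}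
    (X : Matrix (Fin n) (Fin d) ℝ) (ξ : Fin n → ℝ) (Δ : Param d) :
    ξ ⬝ᵥ X.mulVec Δ.ofLp ≤
      (∑ j, |ξ ⬝ᵥ fun i => X i j| ^ q) ^ (1 / q) * lpNorm p Δ := by
  have hc : p.HolderConjugate q := Real.holderConjugate_iff.2 ⟨hp, by simpa using hpq⟩
  rw [Matrix.dotProduct_mulVec]
  exact Real.inner_le_Lp_mul_Lq Finset.univ _ _ hc.symm

/-- The pointwise comparison of a power with a Gaussian exponential. -/
lemma abs_rpow_le_mul_exp {q m : ℝ} (hq : 0 < q) (hm : 0 < m) (z : ℝ) :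
    |z| ^ q ≤ Real.sqrt (2 * m * q) ^ q * Real.exp (z ^ 2 / (8 * m)) := by
  -- This scale makes `t ≤ exp (t / 2)`, raised to the power `q / 2`, produce exactly `exp (z ^ 2 /
  -- (8 m))`.
  set t := z ^ 2 / (2 * m * q) with ht
  have ht0 : 0 ≤ t := by positivity
  have h1 : t ≤ Real.exp (t / 2) := by
    have := Real.quadratic_le_exp_of_nonneg (by positivity : 0 ≤ t / 2)
    nlinarith [sq_nonneg (t - 2)]
  have e1 : |z| = Real.sqrt (2 * m * q) * Real.sqrt t := by
    rw [← Real.sqrt_mul (by positivity), ht, mul_div_cancel₀ _ (by positivity),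
      Real.sqrt_sq_eq_abs]
  have e2 : Real.exp (z ^ 2 / (8 * m)) = Real.exp (t / 2) ^ (q / 2) := by
    rw [← Real.exp_mul]; congr 1; rw [ht]; field_simp; norm_num
  rw [e1, Real.mul_rpow (Real.sqrt_nonneg _) (Real.sqrt_nonneg _), e2]
  refine mul_le_mul_of_nonneg_left ?_ (Real.rpow_nonneg (Real.sqrt_nonneg _) _)
  rw [Real.sqrt_eq_rpow t, ← Real.rpow_mul ht0, one_div_mul_eq_div]
  exact Real.rpow_le_rpow ht0 h1 (by positivity)

/-- Near `p = 1` the `ℓ_1` geometry suffices: `1 / q ≤ 1 / log d` gives `d ^ (1 / q) ≤ e ≤ 3`, and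
one summand of the exponential sum bounds each correlation, using `150 ≤ 2 ^ 8` and `d ≥ 2`. -/
lemma offset_gaussian_le_of_small_p {p q : ℝ} (hp : 1 < p) (hpq : 1 / p + 1 / q = 1) {n d : ℕ}
    (hn : 1 ≤ n) (hd : 2 ≤ d) (hpd : p ≤ 1 + 1 / Real.log d) {X : Fin n → Fin d → ℝ}
    {ξ : Fin n → ℝ} (hX : correlationExpSum X ξ ≤ 150 * d) (Δ : Param d) :
    ξ ⬝ᵥ (Matrix.of X).mulVec Δ.ofLp ≤
      27 * (Real.sqrt n * Real.sqrt (Real.log d)) * lpNorm p Δ := by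
  have hn0 : (0 : ℝ) < n := by exact_mod_cast hn
  have hd2 : (2 : ℝ) ≤ d := by exact_mod_cast hd
  have hd0 : (0 : ℝ) < d := by linarith
  have hlog : Real.log 2 ≤ Real.log d := Real.log_le_log two_pos hd2
  have hl2 : 0 < Real.log 2 := Real.log_pos one_lt_two
  have hmax : ∀ j, |ξ ⬝ᵥ fun i => X i j| ≤ 9 * (Real.sqrt n * Real.sqrt (Real.log d)) := fun j => by
    have h1 : Real.exp ((ξ ⬝ᵥ fun i => X i j) ^ 2 / (8 * n)) ≤ 150 * d :=
      (Finset.single_le_sum (f := fun j => Real.exp ((ξ ⬝ᵥ fun i => X i j) ^ 2 / (8 * n)))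
        (fun j _ => (Real.exp_pos _).le) (Finset.mem_univ j)).trans hX
    rw [← Real.le_log_iff_exp_le (by positivity), Real.log_mul (by norm_num) hd0.ne',
      div_le_iff₀ (by positivity)] at h1
    have h2 : Real.log 150 ≤ 8 * Real.log 2 := by
      rw [show 8 * Real.log 2 = Real.log (2 ^ 8) by rw [Real.log_pow]; norm_num]
      exact Real.log_le_log (by norm_num) (by norm_num)
    refine abs_le_of_sq_le_sq ?_ (by positivity)
    rw [mul_pow, mul_pow, Real.sq_sqrt hn0.le, Real.sq_sqrt (by linarith)]
    have h3 : (Real.log 150 + Real.log d) * (8 * n) ≤ (9 * Real.log d) * (8 * n) :=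
      mul_le_mul_of_nonneg_right (by linarith) (by positivity)
    have h4 : 0 ≤ n * Real.log d := mul_nonneg hn0.le (by linarith)
    linarith
  have h1 := dotProduct_mulVec_le_mul_sum_abs (Matrix.of X) ξ Δ.ofLp hmax
  refine h1.trans ?_
  have hq : 1 / q * Real.log d ≤ 1 := by
    have hlog0 : 0 < Real.log d := by linarith
    have e : 1 / q = (p - 1) / p := by
      rw [← eq_sub_iff_add_eq'] at hpq
      rw [hpq]
      field_simp
    have h2 : (p - 1) / p ≤ p - 1 := div_le_self (by linarith) hp.le
    have h3 : 1 / q ≤ 1 / Real.log d := by rw [e]; linarith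
    calc 1 / q * Real.log d ≤ 1 / Real.log d * Real.log d :=
          mul_le_mul_of_nonneg_right h3 hlog0.le
      _ = 1 := by field_simp
  have hdq : (d : ℝ) ^ (1 / q) ≤ 3 := by
    rw [Real.rpow_def_of_pos hd0, mul_comm]
    have := Real.exp_one_lt_d9
    have := Real.exp_le_exp.2 hq
    linarith
  have h2 : ∑ j, |Δ.ofLp j| ≤ 3 * lpNorm p Δ :=
    (sum_abs_le_rpow_mul_lpNorm hp hpq Δ).trans
      (mul_le_mul_of_nonneg_right hdq (lpNorm_nonneg p Δ))
  have h3 := mul_le_mul_of_nonneg_left h2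
    (by positivity : 0 ≤ 9 * (Real.sqrt n * Real.sqrt (Real.log d)))
  linarith

/-- Hölder duality reduces the claim to the `ℓ_q` norm of `Xᵀξ`, which the exponential sum controls
term by term; `225 = 1.5 · 150`. -/
lemma offset_gaussian_le_of_large_p {p q : ℝ} (hp : 1 < p) (hpq : 1 / p + 1 / q = 1) {n d : ℕ}
    (hn : 1 ≤ n) {X : Fin n → Fin d → ℝ}
    {ξ : Fin n → ℝ} (hX : correlationExpSum X ξ ≤ 150 * d) (Δ : Param d) :
    ξ ⬝ᵥ (Matrix.of X).mulVec Δ.ofLp ≤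
      225 * (Real.sqrt n * Real.sqrt q * (d : ℝ) ^ (1 / q)) * lpNorm p Δ := by
  have hn0 : (0 : ℝ) < n := by exact_mod_cast hn
  have hc : p.HolderConjugate q := Real.holderConjugate_iff.2 ⟨hp, by simpa using hpq⟩
  have hq : 1 < q := hc.symm.lt
  have hq0 : 0 < q := by linarith
  refine (dotProduct_mulVec_le_lq hp hpq (Matrix.of X) ξ Δ).trans
    (mul_le_mul_of_nonneg_right ?_ (lpNorm_nonneg p Δ))
  set s := Real.sqrt (2 * n * q) with hs
  have hs0 : 0 ≤ s := Real.sqrt_nonneg _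
  have h1 : ∑ j, |ξ ⬝ᵥ fun i => X i j| ^ q ≤ s ^ q * (150 * d) := by
    refine (Finset.sum_le_sum fun j _ => abs_rpow_le_mul_exp hq0 hn0 _).trans ?_
    rw [← Finset.mul_sum]
    exact mul_le_mul_of_nonneg_left hX (Real.rpow_nonneg hs0 _)
  have h2 : (150 : ℝ) ^ (1 / q) ≤ 150 := by
    conv_rhs => rw [← Real.rpow_one 150]
    exact Real.rpow_le_rpow_of_exponent_le (by norm_num) ((div_le_one hq0).2 hq.le)
  have h3 : s ≤ 1.5 * (Real.sqrt n * Real.sqrt q) := by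
    rw [hs, Real.sqrt_mul (by positivity), Real.sqrt_mul zero_le_two, mul_assoc]
    exact mul_le_mul_of_nonneg_right
      (Real.sqrt_le_iff.2 ⟨by norm_num, by norm_num⟩) (by positivity)
  calc (∑ j, |ξ ⬝ᵥ fun i => X i j| ^ q) ^ (1 / q) ≤ (s ^ q * (150 * d)) ^ (1 / q) :=
        Real.rpow_le_rpow (Finset.sum_nonneg fun j _ => Real.rpow_nonneg (abs_nonneg _) _) h1
          (by positivity)
    _ = s * (150 ^ (1 / q) * (d : ℝ) ^ (1 / q)) := by
        rw [Real.mul_rpow (Real.rpow_nonneg hs0 _) (by positivity), ← Real.rpow_mul hs0,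
          mul_one_div_cancel hq0.ne', Real.rpow_one, Real.mul_rpow (by norm_num) (by positivity)]
    _ ≤ (1.5 * (Real.sqrt n * Real.sqrt q)) * (150 * (d : ℝ) ^ (1 / q)) := by gcongr
    _ = _ := by ring

lemma gaussianRate_pos {p q τ : ℝ} (hp : 1 < p) (hpq : 1 / p + 1 / q = 1) {n d : ℕ}
    (hn : 1 ≤ n) (hd : 2 ≤ d) (hτ : 0 < τ) : 0 < gaussianRate p q τ n d := by
  have hn0 : (0 : ℝ) < n := by exact_mod_cast hn
  have hd2 : (2 : ℝ) ≤ d := by exact_mod_cast hd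
  have hlog : 0 < Real.log d := Real.log_pos (by linarith)
  have hc : p.HolderConjugate q := Real.holderConjugate_iff.2 ⟨hp, by simpa using hpq⟩
  have hq : 0 < q := hc.symm.pos
  unfold gaussianRate
  refine lt_min one_pos (mul_pos (by positivity) ?_)
  split_ifs <;> positivity

lemma offset_gaussianRate_le {p q τ : ℝ} (hp : 1 < p) (hpq : 1 / p + 1 / q = 1) {n d : ℕ}
    (hn : 1 ≤ n) (hd : 2 ≤ d) (hτ : 0 < τ) {X : Fin n → Fin d → ℝ} {ξ : Fin n → ℝ}
    (hξ : sqNorm ξ ≤ 2 * n) (hX : correlationExpSum X ξ ≤ 150 * d) {Δ : Param d}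
    (hΔ : lpNorm p Δ ≤ (2 + Real.sqrt 2) * τ) :
    2 * (ξ ⬝ᵥ (Matrix.of X).mulVec Δ.ofLp) - sqNorm ((Matrix.of X).mulVec Δ.ofLp) ≤
      n * (1800 * gaussianRate p q τ n d) := by
  have hn0 : (0 : ℝ) < n := by exact_mod_cast hn
  have hΔ' : lpNorm p Δ ≤ 4 * τ := by
    have : Real.sqrt 2 ≤ 2 := Real.sqrt_le_iff.2 ⟨by norm_num, by norm_num⟩
    exact hΔ.trans (mul_le_mul_of_nonneg_right (by linarith) hτ.le)
  have hsq := sqNorm_nonneg ((Matrix.of X).mulVec Δ.ofLp)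
  have hlin : ∀ {G : ℝ}, 0 ≤ G →
      ξ ⬝ᵥ (Matrix.of X).mulVec Δ.ofLp ≤ 225 * (Real.sqrt n * G) * lpNorm p Δ →
      2 * (ξ ⬝ᵥ (Matrix.of X).mulVec Δ.ofLp) - sqNorm ((Matrix.of X).mulVec Δ.ofLp) ≤
        n * (1800 * (τ / Real.sqrt n * G)) := fun {G} hG h => by
    have h1 := mul_le_mul_of_nonneg_left hΔ' (by positivity : 0 ≤ 225 * (Real.sqrt n * G))
    have h0 : 0 < Real.sqrt n := Real.sqrt_pos.2 hn0
    -- `1800 = 2 · 225 · 4`, with `4 ≥ 2 + √2` from the radius.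
    have e : n * (1800 * (τ / Real.sqrt n * G)) = 2 * (225 * (Real.sqrt n * G) * (4 * τ)) := by
      have hN : Real.sqrt n * Real.sqrt n = n := Real.mul_self_sqrt hn0.le
      nth_rewrite 1 [← hN]
      field_simp
      ring
    linarith
  unfold gaussianRate
  rcases le_total 1 (τ / Real.sqrt n *
    if p ≤ 1 + 1 / Real.log d then Real.sqrt (Real.log d) else Real.sqrt q * (d : ℝ) ^ (1 / q))
    with h | h
  · rw [min_eq_left h]
    -- When the rate is `1`, completing the square bounds the offset by `‖ξ‖² ≤ 2n`.
    have h1 := sqNorm_nonneg (ξ - (Matrix.of X).mulVec Δ.ofLp)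
    rw [sqNorm_sub] at h1
    linarith
  · rw [min_eq_right h]
    split_ifs with hpd
    · refine hlin (Real.sqrt_nonneg _)
        ((offset_gaussian_le_of_small_p hp hpq hn hd hpd hX Δ).trans ?_)
      have := lpNorm_nonneg p Δ
      gcongr
      norm_num
    · refine hlin (by positivity) ?_
      rw [← mul_assoc (Real.sqrt n)]
      exact offset_gaussian_le_of_large_p hp hpq hn hX Δ

theorem withProbAtLeast_gaussianRate {p q τ : ℝ} (hp : 1 < p) (hp2 : p < 2)
    (hpq : 1 / p + 1 / q = 1) {n d : ℕ} (hn : 1 ≤ n) (hd : 2 ≤ d) (hτ : 0 < τ) :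
    WithProbAtLeast ((designLaw n d).prod (noiseLaw n)) (0.99 - 2 * Real.exp (-0.1 * n))
      {ω | LpESMDRiskLE p τ (gaussianRate p q τ n d) (1801 * gaussianRate p q τ n d)
        (Matrix.of ω.1) ω.2} := by
  have hd1 : 1 ≤ d := by omega
  obtain ⟨B, hBm, hB, hgood⟩ := exists_design_bad_set hn hd1
  have hAm : MeasurableSet {ξ : Fin n → ℝ | 2 * (n : ℝ) < sqNorm ξ} :=
    measurableSet_lt measurable_const measurable_sqNorm
  have hA : ((designLaw n d).prod (noiseLaw n)).real
      (Prod.snd ⁻¹' {ξ : Fin n → ℝ | 2 * (n : ℝ) < sqNorm ξ}) ≤ Real.exp (-0.1 * n) := by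
    rw [measurePreserving_snd.measureReal_preimage hAm.nullMeasurableSet]
    exact measureReal_two_mul_lt_sqNorm_le n
  refine withProbAtLeast_of_bad_sets (measurable_snd hAm) hBm hA hB ?_ fun ω hω hωB => ?_
  -- The bad sets have total mass at most `0.01 + exp (-0.1 n)`; the second exponential is slack.
  · have := Real.exp_pos (-0.1 * (n : ℝ))
    norm_num at this ⊢
    linarith
  · have hξ : sqNorm ω.2 ≤ 2 * n := not_lt.1 hω
    have hr := gaussianRate_pos hp hpq hn hd hτ
    have h := lpESMDRiskLE_of_offset hp hp2 hn hd1 hτ hr (mul_pos (by norm_num) hr).le hξ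
      fun Δ hΔ => offset_gaussianRate_le hp hpq hn hd hτ hξ (hgood ω hωB hξ) hΔ
    rw [show (1801 : ℝ) * gaussianRate p q τ n d =
      gaussianRate p q τ n d + 1800 * gaussianRate p q τ n d by ring]
    exact h

end ESMD

open ESMD in
theorem proposition4p1 :
    -- the potential is a mirror map and satisfies the assumptions, with `cl = cu = 1`
    (∀ (p : ℝ) (d : ℕ), 1 < p → p < 2 → 1 ≤ d →
      IsMirrorMap (lpPotential p (d := d)) ∧
      ∀ τ : ℝ, 0 < τ →
        DiscreteAssumption (lpBall p d) τ (lpNorm p) (2 * (p - 1)) 1 1 (lpPotential p)) ∧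
    -- column-normalized design
    (∀ (p q : ℝ) (n d : ℕ) (τ δ : ℝ) (X : Matrix (Fin n) (Fin d) ℝ),
      1 < p → p < 2 → 1 / p + 1 / q = 1 → 1 ≤ n → 1 ≤ d → 0 < τ → 0 < δ → δ < 1 →
      ColumnNormalized X →
      WithProbAtLeast (noiseLaw n) (1 - Real.exp (-0.1 * n) - δ)
        {ξ | LpESMDRiskLE p τ (columnBound q τ δ X / 2) (columnBound q τ δ X) X ξ}) ∧
    -- Gaussian design
    (∃ C : ℝ, 0 < C ∧ ∀ (p q : ℝ) (n d : ℕ) (τ : ℝ),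
      1 < p → p < 2 → 1 / p + 1 / q = 1 → 1 ≤ n → 2 ≤ d → 0 < τ →
      WithProbAtLeast ((designLaw n d).prod (noiseLaw n)) (0.99 - 2 * Real.exp (-0.1 * n))
        {ω | LpESMDRiskLE p τ (gaussianRate p q τ n d) (C * gaussianRate p q τ n d)
          (Matrix.of ω.1) ω.2}) :=
  ⟨fun _ _ hp hp2 hd => ⟨isMirrorMap_lpPotential hp hp2 hd,
      fun _ hτ => discreteAssumption_lpPotential hp hp2 hd hτ⟩,
    fun _ _ _ _ _ _ _ hp hp2 hpq hn hd hτ hδ hδ1 hX =>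
      withProbAtLeast_columnBound hp hp2 hpq hn hd hτ hδ hδ1 hX,
    1801, by norm_num, fun _ _ _ _ _ hp hp2 hpq hn hd hτ =>
      withProbAtLeast_gaussianRate hp hp2 hpq hn hd hτ⟩
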